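/- Let $A$ be a unital C*-algebra, let $A=\mathcal R_0\supseteq\mathcal R_1\supseteq\mathcal R_2\supseteq\cdots$ be a decreasing sequence of closed unital *-subalgebras, and let $E_n:A\to\mathcal R_n$ ($n\in\mathbb N=\{0,1,2,\dots\}$) be faithful conditional expectations onto $\mathcal R_n$ with $E_{n+1}\circ E_n=E_{n+1}$ for all $n$. Write $\mathcal R=\{\mathcal R_n\}$ and $\mathcal E=\{E_n\}$. Let $\mathcal T(\mathcal R,\mathcal E)$, the Toeplitz algebra, be the universal unital C*-algebra generated by (a unital *-homomorphic image of) $A$, the image of $a$ being written $\underline a$, and projections $\hat e_n$ ($n\in\mathbb N$) subject to $\hat e_0=1$, $\hat e_{n+1}\hat e_n=\hat e_{n+1}$ and $\hat e_n\underline a\hat e_n=\underline{E_n(a)}\hat e_n$ for all $a\in A$, $n\in\mathbb N$. Let $\hat{\mathcal K}_n$ be the closed linear span of $\{\underline a\hat e_n\underline b: a,b\in A\}$. An $n$-redundancy is a tuple $(k_0,\dots,k_n)\in\prod_{i=0}^n\hat{\mathcal K}_i$ with $\sum_{i=0}^n k_ix=0$ for all $x\in\hat{\mathcal K}_n$; the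 redundancy ideal is the closed two-sided ideal of $\mathcal T(\mathcal R,\mathcal E)$ generated by the sums $k_0+\cdots+k_n$ of all $n$-redundancies, for all $n$. Let $C^*(\mathcal R,\mathcal E)$ be the quotient of $\mathcal T(\mathcal R,\mathcal E)$ by the redundancy ideal, $q$ the quotient map, and $e_n=q(\hat e_n)$. Let $M_n$ be the right Hilbert $\mathcal R_n$-module obtained by completing $A$ under $\langle a,b\rangle=E_n(a^*b)$, let $i_n:A\to M_n$ be the canonical map, and let $\mathcal L(M_n)$ be the C*-algebra of adjointable operators on $M_n$. Let $L^n_a\in\mathcal L(M_n)$ be the operator with $L^n_a(i_n(x))=i_n(ax)$ and $\check e_n\in\mathcal L(M_n)$ the projection with $\check e_n(i_n(x))=i_n(E_n(x))$. Let $j_n:M_n\to M_{n+1}$ be the continuous map with $j_n(i_n(a))=i_{n+1}(a)$, and let $\Phi_n:\mathcal L(M_n)\to\mathcal L(M_{n+1})$ be the *-homomorphism with $\Phi_n(T)(j_n(\xi))=j_n(T(\xi))$. Let $\mathcal L_\infty$ be the inductive limit of the C*-algebras $\mathcal L(M_n)$ along the maps $\Phi_n$. Since $\Phi_n(L^n_a)=L^{n+1}_a$,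 the images of the $L^n_a$ in $\mathcal L_\infty$ do not depend on $n$; write $a$ for this image, and write $\check e_n$ also for the image of $\check e_n$ in $\mathcal L_\infty$. Theorem 3.6. (i) There is a unique *-homomorphism $\hat\pi:\mathcal T(\mathcal R,\mathcal E)\to\mathcal L_\infty$ such that $\hat\pi(\underline a)=a$ for all $a\in A$ and $\hat\pi(\hat e_n)=\check e_n$ for all $n\in\mathbb N$. (ii) $\hat\pi$ vanishes on the redundancy ideal, and so it factors as $\hat\pi=\pi\circ q$ for a *-homomorphism $\pi:C^*(\mathcal R,\mathcal E)\to\mathcal L_\infty$ with $\pi(e_n)=\check e_n$ and $\pi(q(\underline a))=a$ for all $n\in\mathbb N$, $a\in A$. (iii) $\pi$ is injective, and it is a *-isomorphism of $C^*(\mathcal R,\mathcal E)$ onto the C*-subalgebra of $\mathcal L_\infty$ generated by $A$ and all the $\check e_n$. In particular the maps $a\mapsto\underline a$ from $A$ to $\mathcal T(\mathcal R,\mathcal E)$ and $a\mapsto q(\underline a)$ from $A$ to $C^*(\mathcal R,\mathcal E)$ are injective. -/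

import Mathlib

open scoped ENNReal Topology
open Filter

universe u v

/-! ## Quotients of C*-algebras by closed two-sided ideals -/

section ClosedIdeals

variable {A : Type u} [CStarAlgebra A]

/-- Elements of a left ideal are absorbed on the right, up to `δ`, by contractions of that ideal. -/
theorem exists_right_absorbing (J : Ideal A) {y : A} (hy : y ∈ J) {δ : ℝ} (hδ : 0 < δ) :
    ∃ w ∈ J, IsSelfAdjoint w ∧ ‖1 - w‖ ≤ 1 ∧ ‖y * (1 - w)‖ ≤ δ := by
  have hb : IsSelfAdjoint (star y * y) := IsSelfAdjoint.star_mul_self y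
  have hε : (0 : ℝ) < δ ^ 2 := by positivity
  have hspec : ∀ t ∈ spectrum ℝ (star y * y), 0 ≤ t := fun t ht =>
    spectrum_star_mul_self_nonneg t ht
  have hne : ∀ t ∈ spectrum ℝ (star y * y), t + δ ^ 2 ≠ 0 := fun t ht =>
    (add_pos_of_nonneg_of_pos (hspec t ht) hε).ne'
  set g : ℝ → ℝ := fun t => δ ^ 2 * (t + δ ^ 2)⁻¹ with hg
  set h : ℝ → ℝ := fun t => (t + δ ^ 2)⁻¹ with hh
  have hhc : ContinuousOn h (spectrum ℝ (star y * y)) :=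
    ContinuousOn.inv₀ (by fun_prop) hne
  have hgc : ContinuousOn g (spectrum ℝ (star y * y)) := continuousOn_const.mul hhc
  have hgsa : IsSelfAdjoint (cfc g (star y * y)) := cfc_predicate g _
  have key : 1 - cfc g (star y * y) = cfc h (star y * y) * (star y * y) := by
    rw [← cfc_one ℝ (star y * y), ← cfc_sub _ _ _ (by fun_prop) hgc]
    nth_rewrite 3 [← cfc_id ℝ (star y * y)]
    rw [← cfc_mul _ _ _ hhc (by fun_prop)]
    refine cfc_congr fun t ht => ?_
    have := hne t ht
    simp only [hg, hh, Pi.one_apply, id]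
    field_simp
    ring
  refine ⟨1 - cfc g (star y * y), ?_, (IsSelfAdjoint.one A).sub hgsa, ?_, ?_⟩
  · rw [key, ← mul_assoc]
    exact J.mul_mem_left _ hy
  · rw [sub_sub_cancel]
    refine norm_cfc_le zero_le_one fun t ht => ?_
    have h0 := hspec t ht
    rw [Real.norm_of_nonneg (by positivity), hg]
    simp only
    rw [mul_inv_le_iff₀ (by positivity)]
    linarith
  · rw [sub_sub_cancel]
    have h1 : star (y * cfc g (star y * y)) * (y * cfc g (star y * y))
        = cfc (fun t => g t * t * g t) (star y * y) := by
      have e1 := cfc_mul (fun t => g t * t) g (star y * y) (hgc.mul continuousOn_id) hgc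
      have e2 := cfc_mul g (fun t => t) (star y * y) hgc continuousOn_id
      rw [e1, e2, cfc_id' ℝ (star y * y), star_mul, hgsa.star_eq]
      noncomm_ring
    have h2 : ‖y * cfc g (star y * y)‖ * ‖y * cfc g (star y * y)‖ ≤ δ ^ 2 := by
      rw [← CStarRing.norm_star_mul_self, h1]
      refine norm_cfc_le hε.le fun t ht => ?_
      have h0 := hspec t ht
      rw [Real.norm_of_nonneg (by positivity), hg]
      simp only
      have h3 : δ ^ 2 * (t + δ ^ 2)⁻¹ ≤ 1 := by
        rw [mul_inv_le_iff₀ (by positivity)]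
        linarith
      have h4 : t * (t + δ ^ 2)⁻¹ ≤ 1 := by
        rw [mul_inv_le_iff₀ (by positivity)]
        linarith
      calc δ ^ 2 * (t + δ ^ 2)⁻¹ * t * (δ ^ 2 * (t + δ ^ 2)⁻¹)
          = δ ^ 2 * (t * (t + δ ^ 2)⁻¹) * (δ ^ 2 * (t + δ ^ 2)⁻¹) := by ring
        _ ≤ δ ^ 2 * 1 * 1 := by gcongr
        _ = δ ^ 2 := by ring
    exact abs_le_of_sq_le_sq' (by rw [sq]; exact h2) hδ.le |>.2

/-- A closed two-sided ideal of a C*-algebra is self-adjoint. -/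
theorem star_mem_of_isClosed (J : Ideal A) [hJ : J.IsTwoSided] [hc : IsClosed (J : Set A)]
    {a : A} (ha : a ∈ J) : star a ∈ J := by
  rw [← SetLike.mem_coe, ← hc.closure_eq, Metric.mem_closure_iff]
  intro ε hε
  obtain ⟨w, hw, hsa, -, hle⟩ := exists_right_absorbing J ha (half_pos hε)
  refine ⟨w * star a, J.mul_mem_right _ hw, ?_⟩
  have h1 : star a - w * star a = star (a * (1 - w)) := by
    rw [star_mul, star_sub, star_one, hsa.star_eq]
    noncomm_ring
  rw [dist_eq_norm, h1, norm_star]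
  linarith

namespace CStarQuotient

variable (J : Ideal A) [J.IsTwoSided] [hc : IsClosed (J : Set A)]

/-- The quotient ring with the quotient norm `‖a + J‖ = inf {‖a + y‖ : y ∈ J}`. -/
noncomputable instance instNormedRing : NormedRing (A ⧸ J) where
  __ := Ideal.Quotient.ring J
  __ := Submodule.Quotient.normedAddCommGroup J
  norm_mul_le x y := le_of_forall_pos_le_add fun ε hε => by
    have := ((Metric.nhds_basis_ball.prod_nhds Metric.nhds_basis_ball).tendsto_iff
      Metric.nhds_basis_ball).mp (continuous_mul.tendsto (‖x‖, ‖y‖)) ε hε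
    simp only [Set.mem_prod, Metric.mem_ball, and_imp, Prod.forall, Prod.exists] at this
    rcases this with ⟨ε₁, ε₂, ⟨h₁, h₂⟩, h⟩
    obtain ⟨a, rfl, ha⟩ := Submodule.Quotient.norm_mk_lt x h₁
    obtain ⟨b, rfl, hb⟩ := Submodule.Quotient.norm_mk_lt y h₂
    simp only [dist, abs_sub_lt_iff] at h
    specialize h ‖a‖ ‖b‖ ⟨by linarith, by linarith [Submodule.Quotient.norm_mk_le J a]⟩
      ⟨by linarith, by linarith [Submodule.Quotient.norm_mk_le J b]⟩
    calc
      _ ≤ ‖a‖ * ‖b‖ := (Submodule.Quotient.norm_mk_le J (a * b)).trans (norm_mul_le a b)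
      _ ≤ _ := (sub_lt_iff_lt_add'.mp h.1).le

noncomputable instance instNormedAlgebra : NormedAlgebra ℂ (A ⧸ J) where
  __ := Ideal.Quotient.algebra ℂ
  norm_smul_le := (Submodule.Quotient.normedSpace J ℂ).norm_smul_le

theorem star_rel {a b : A} (h : Ideal.Quotient.mk J a = Ideal.Quotient.mk J b) :
    Ideal.Quotient.mk J (star a) = Ideal.Quotient.mk J (star b) := by
  rw [Ideal.Quotient.mk_eq_mk_iff_sub_mem] at h ⊢
  rw [← star_sub]
  exact star_mem_of_isClosed J h

/-- The involution `(a + J)* = a* + J`. -/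
noncomputable instance instStarRing : StarRing (A ⧸ J) where
  star := Quotient.lift (fun a => Ideal.Quotient.mk J (star a)) fun _ _ h =>
    star_rel J (Quotient.sound h)
  star_involutive := by
    rintro ⟨a⟩
    exact congrArg (Ideal.Quotient.mk J) (star_star a)
  star_mul := by
    rintro ⟨a⟩ ⟨b⟩
    exact congrArg (Ideal.Quotient.mk J) (star_mul a b)
  star_add := by
    rintro ⟨a⟩ ⟨b⟩
    exact congrArg (Ideal.Quotient.mk J) (star_add a b)

instance instStarModule : StarModule ℂ (A ⧸ J) where
  star_smul := by
    rintro c ⟨a⟩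
    exact congrArg (Ideal.Quotient.mk J) (star_smul c a)

instance instCStarRing : CStarRing (A ⧸ J) where
  norm_mul_self_le := by
    intro x
    obtain ⟨a, rfl⟩ := Ideal.Quotient.mk_surjective x
    refine le_of_forall_pos_le_add fun ε hε => ?_
    obtain ⟨b, hb, hlt⟩ := Submodule.Quotient.norm_mk_lt
      (star (Ideal.Quotient.mk J a) * Ideal.Quotient.mk J a) (half_pos hε)
    have hy : b - star a * a ∈ J := by
      rw [← Ideal.Quotient.mk_eq_mk_iff_sub_mem]
      exact hb
    obtain ⟨w, hw, hsa, h1, h2⟩ := exists_right_absorbing J hy (half_pos hε)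
    have hq : Ideal.Quotient.mk J a = Ideal.Quotient.mk J (a * (1 - w)) := by
      rw [Ideal.Quotient.mk_eq_mk_iff_sub_mem]
      have : a - a * (1 - w) = a * w := by noncomm_ring
      rw [this]
      exact J.mul_mem_left _ hw
    have h3 : ‖Ideal.Quotient.mk J a‖ ≤ ‖a * (1 - w)‖ := by
      rw [hq]
      exact Submodule.Quotient.norm_mk_le J _
    have hsa' : star (1 - w) = 1 - w := by rw [star_sub, star_one, hsa.star_eq]
    have h4 : star (a * (1 - w)) * (a * (1 - w))
        = (1 - w) * (b * (1 - w) - (b - star a * a) * (1 - w)) := by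
      rw [star_mul, hsa']
      noncomm_ring
    calc ‖Ideal.Quotient.mk J a‖ * ‖Ideal.Quotient.mk J a‖
        ≤ ‖a * (1 - w)‖ * ‖a * (1 - w)‖ := by gcongr
      _ = ‖(1 - w) * (b * (1 - w) - (b - star a * a) * (1 - w))‖ := by
          rw [← CStarRing.norm_star_mul_self, h4]
      _ ≤ 1 * (‖b‖ * 1 + ε / 2) := by
          refine (norm_mul_le _ _).trans ?_
          gcongr
          refine (norm_sub_le _ _).trans ?_
          gcongr
          refine (norm_mul_le _ _).trans ?_
          gcongr
      _ ≤ ‖star (Ideal.Quotient.mk J a) * Ideal.Quotient.mk J a‖ + ε := by linarith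

instance instCompleteSpace : CompleteSpace (A ⧸ J) := Submodule.Quotient.completeSpace J

/-- The quotient of a unital C*-algebra by a closed two-sided ideal. -/
noncomputable instance instCStarAlgebra : CStarAlgebra (A ⧸ J) where

/-- The quotient map as a *-homomorphism. -/
noncomputable def mk : A →⋆ₐ[ℂ] A ⧸ J where
  __ := Ideal.Quotient.mkₐ ℂ J
  map_star' _ := rfl

end CStarQuotient

/-- The closed two-sided ideal generated by a set, that is, the smallest one containing it. -/
def closedIdealSpan (S : Set A) : Ideal A :=
  sInf {J : Ideal A | J.IsTwoSided ∧ IsClosed (J : Set A) ∧ S ⊆ J}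

instance (S : Set A) : (closedIdealSpan S).IsTwoSided := by
  refine ⟨fun {a} b ha => ?_⟩
  rw [closedIdealSpan, Submodule.mem_sInf] at ha ⊢
  intro J hJ
  have := hJ.1
  exact Ideal.mul_mem_right b J (ha J hJ)

instance (S : Set A) : IsClosed (closedIdealSpan S : Set A) := by
  rw [closedIdealSpan, Submodule.coe_sInf]
  exact isClosed_biInter fun J hJ => hJ.2.1

end ClosedIdeals

/-! ## Bounded products and inductive limits of C*-algebras -/

section BoundedProduct

variable {I : Type u} (B : I → Type v) [∀ i, CStarAlgebra (B i)]

/-- The C*-algebra of all bounded families `(b i)`, `b i ∈ B i`, with the supremum norm. -/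
def BoundedProd : Type (max u v) := lp B ∞

namespace BoundedProd

noncomputable instance : NonUnitalCStarAlgebra (BoundedProd B) :=
  inferInstanceAs (NonUnitalCStarAlgebra (lp B ∞))

variable {B}

/-- The coordinates of a bounded family. -/
def coord (x : BoundedProd B) (i : I) : B i := (x : lp B ∞).1 i

instance : CoeFun (BoundedProd B) (fun _ => ∀ i, B i) := ⟨coord⟩

theorem norm_one_le (C : Type v) [CStarAlgebra C] : ‖(1 : C)‖ ≤ 1 := by
  rcases subsingleton_or_nontrivial C with h | h
  · rw [Subsingleton.elim (1 : C) 0, norm_zero]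
    exact zero_le_one
  · exact CStarRing.norm_one.le

/-- A bounded family as an element of the product. -/
def of (b : ∀ i, B i) (C : ℝ) (h : ∀ i, ‖b i‖ ≤ C) : BoundedProd B :=
  ⟨b, memℓp_infty ⟨C, by rintro _ ⟨i, rfl⟩; exact h i⟩⟩

@[ext] theorem ext {x y : BoundedProd B} (h : ∀ i, x i = y i) : x = y :=
  Subtype.ext (funext h)

noncomputable instance : One (BoundedProd B) := ⟨of (fun _ => 1) 1 fun i => norm_one_le (B i)⟩

@[simp] theorem of_apply (b : ∀ i, B i) (C : ℝ) (h : ∀ i, ‖b i‖ ≤ C) (i : I) :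
    of b C h i = b i := rfl
@[simp] theorem one_apply (i : I) : (1 : BoundedProd B) i = 1 := rfl
@[simp] theorem zero_apply (i : I) : (0 : BoundedProd B) i = 0 := rfl
@[simp] theorem add_apply (x y : BoundedProd B) (i : I) : (x + y) i = x i + y i := rfl
@[simp] theorem sub_apply (x y : BoundedProd B) (i : I) : (x - y) i = x i - y i := rfl
@[simp] theorem mul_apply (x y : BoundedProd B) (i : I) : (x * y) i = x i * y i := rfl
@[simp] theorem smul_apply (c : ℂ) (x : BoundedProd B) (i : I) : (c • x) i = c • x i := rfl
@[simp] theorem star_apply (x : BoundedProd B) (i : I) : (star x) i = star (x i) := rfl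

theorem norm_apply_le (x : BoundedProd B) (i : I) : ‖x i‖ ≤ ‖x‖ :=
  lp.norm_apply_le_norm ENNReal.top_ne_zero (x : lp B ∞) i

noncomputable instance instNormedRing : NormedRing (BoundedProd B) where
  __ := (inferInstance : NonUnitalNormedRing (BoundedProd B))
  one_mul x := by ext i; simp
  mul_one x := by ext i; simp

noncomputable instance instNormedAlgebra : NormedAlgebra ℂ (BoundedProd B) where
  __ := Algebra.ofModule (R := ℂ) (A := BoundedProd B) (fun c x y => smul_mul_assoc c x y)
    (fun c x y => mul_smul_comm c x y)
  norm_smul_le := norm_smul_le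

noncomputable instance instCStarAlgebra : CStarAlgebra (BoundedProd B) where
  norm_mul_self_le := CStarRing.norm_mul_self_le

end BoundedProd

end BoundedProduct

section InductiveLimit

variable (B : ℕ → Type u) [∀ n, CStarAlgebra (B n)]

/-- The ideal of the sequences `(b n)` in the bounded product with `‖b n‖ → 0`. -/
noncomputable def nullIdeal : Ideal (BoundedProd B) where
  carrier := {x | Tendsto (fun n => ‖x n‖) atTop (𝓝 0)}
  zero_mem' := by simp
  add_mem' {x y} hx hy := by
    refine squeeze_zero (fun n => norm_nonneg _) (fun n => norm_add_le (x n) (y n)) ?_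
    simpa using Tendsto.add hx hy
  smul_mem' c x hx := by
    refine squeeze_zero (fun n => norm_nonneg _)
      (fun n => (norm_mul_le (c n) (x n)).trans
        (mul_le_mul_of_nonneg_right (BoundedProd.norm_apply_le c n) (norm_nonneg _))) ?_
    simpa using Tendsto.const_mul ‖c‖ hx

instance : (nullIdeal B).IsTwoSided := by
  refine ⟨fun {x} c hx => ?_⟩
  refine squeeze_zero (fun n => norm_nonneg _)
    (fun n => (norm_mul_le (x n) (c n)).trans
      (mul_le_mul_of_nonneg_left (BoundedProd.norm_apply_le c n) (norm_nonneg _))) ?_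
  simpa using Tendsto.mul_const ‖c‖ hx

instance : IsClosed (nullIdeal B : Set (BoundedProd B)) := by
  refine isClosed_of_closure_subset fun x hx => ?_
  change Tendsto (fun n => ‖x n‖) atTop (𝓝 0)
  rw [Metric.tendsto_atTop]
  intro ε hε
  obtain ⟨y, hy, hd⟩ := Metric.mem_closure_iff.1 hx (ε / 2) (half_pos hε)
  obtain ⟨N, hN⟩ := Metric.tendsto_atTop.1 (show Tendsto (fun n => ‖y n‖) atTop (𝓝 0) from hy)
    (ε / 2) (half_pos hε)
  refine ⟨N, fun n hn => ?_⟩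
  have h1 := hN n hn
  have h2 : ‖(x - y) n‖ ≤ ‖x - y‖ := BoundedProd.norm_apply_le (x - y) n
  rw [dist_eq_norm] at hd
  rw [Real.dist_eq, sub_zero, abs_norm] at h1 ⊢
  have h3 : ‖x n‖ ≤ ‖x n - y n‖ + ‖y n‖ := by
    simpa using norm_add_le (x n - y n) (y n)
  rw [BoundedProd.sub_apply] at h2
  linarith

variable {B} (Φ : ∀ n, B n →⋆ₐ[ℂ] B (n + 1))

/-- The bounded sequences that are eventually coherent with the connecting maps. -/
noncomputable def eventuallyCoherent : StarSubalgebra ℂ (BoundedProd B) where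
  carrier := {x | ∃ N, ∀ n ≥ N, x (n + 1) = Φ n (x n)}
  mul_mem' := by
    rintro x y ⟨N, hN⟩ ⟨M, hM⟩
    refine ⟨max N M, fun n hn => ?_⟩
    simp [hN n (le_of_max_le_left hn), hM n (le_of_max_le_right hn)]
  add_mem' := by
    rintro x y ⟨N, hN⟩ ⟨M, hM⟩
    refine ⟨max N M, fun n hn => ?_⟩
    simp [hN n (le_of_max_le_left hn), hM n (le_of_max_le_right hn)]
  algebraMap_mem' c := by
    refine ⟨0, fun n _ => ?_⟩
    simp [Algebra.algebraMap_eq_smul_one]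
  star_mem' := by
    rintro x ⟨N, hN⟩
    exact ⟨N, fun n hn => by simp [hN n hn, map_star]⟩

/-- The inductive limit of the sequence of C*-algebras `B 0 → B 1 → B 2 → ⋯`, realized as the
closure of the eventually coherent sequences modulo the null sequences. -/
noncomputable def inductiveLimitSubalgebra :
    StarSubalgebra ℂ (BoundedProd B ⧸ nullIdeal B) :=
  ((eventuallyCoherent Φ).map (CStarQuotient.mk (nullIdeal B))).topologicalClosure

instance : IsClosed (inductiveLimitSubalgebra Φ : Set (BoundedProd B ⧸ nullIdeal B)) :=
  StarSubalgebra.isClosed_topologicalClosure _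

/-- The inductive limit as a C*-algebra. -/
def InductiveLimit : Type u := inductiveLimitSubalgebra Φ

namespace InductiveLimit

noncomputable instance : CStarAlgebra (InductiveLimit Φ) :=
  inferInstanceAs (CStarAlgebra (inductiveLimitSubalgebra Φ))

/-- The sequence `0, …, 0, b, Φ n b, Φ (n + 1) (Φ n b), …` with `b` at the place `n`. -/
noncomputable def seq (n : ℕ) (b : B n) (m : ℕ) : B m :=
  if h : n ≤ m then Nat.leRecOn h (fun {k} x => Φ k x) b else 0

theorem seq_self (n : ℕ) (b : B n) : seq Φ n b n = b := by
  rw [seq, dif_pos le_rfl, Nat.leRecOn_self]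

theorem seq_of_lt {n m : ℕ} (h : m < n) (b : B n) : seq Φ n b m = 0 := by
  rw [seq, dif_neg (not_le.2 h)]

theorem seq_succ {n m : ℕ} (h : n ≤ m) (b : B n) : seq Φ n b (m + 1) = Φ m (seq Φ n b m) := by
  rw [seq, seq, dif_pos h, dif_pos (h.trans m.le_succ), Nat.leRecOn_succ h]

/-- A relation between sequences that holds at the place `n` and is preserved by the connecting
maps holds from there on. -/
theorem seq_ind (n : ℕ) {P : ℕ → Prop} (h0 : P n) (hs : ∀ m ≥ n, P m → P (m + 1)) :
    ∀ m ≥ n, P m := fun _ hm => Nat.le_induction h0 hs _ hm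

theorem norm_seq_le (n : ℕ) (b : B n) (m : ℕ) : ‖seq Φ n b m‖ ≤ ‖b‖ := by
  rcases lt_or_ge m n with h | h
  · rw [seq_of_lt Φ h, norm_zero]
    exact norm_nonneg b
  · refine Nat.le_induction ?_ ?_ m h
    · rw [seq_self]
    · intro k hk ih
      rw [seq_succ Φ hk]
      exact (NonUnitalStarAlgHom.norm_apply_le (Φ k) _).trans ih

noncomputable def bseq (n : ℕ) (b : B n) : BoundedProd B :=
  BoundedProd.of (seq Φ n b) ‖b‖ (norm_seq_le Φ n b)

theorem bseq_mem (n : ℕ) (b : B n) : bseq Φ n b ∈ eventuallyCoherent Φ :=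
  ⟨n, fun _ hm => seq_succ Φ hm b⟩

/-- Two bounded sequences that agree from some place on have the same class. -/
theorem mk_eq_mk {x y : BoundedProd B} (n : ℕ) (h : ∀ m ≥ n, x m = y m) :
    CStarQuotient.mk (nullIdeal B) x = CStarQuotient.mk (nullIdeal B) y := by
  refine (Ideal.Quotient.mk_eq_mk_iff_sub_mem x y).2 ?_
  change Tendsto (fun m => ‖(x - y) m‖) atTop (𝓝 0)
  refine tendsto_const_nhds.congr' ?_
  filter_upwards [eventually_ge_atTop n] with m hm
  simp [h m hm]

/-- The canonical map of `B n` into the inductive limit. -/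
noncomputable def of (n : ℕ) : B n →⋆ₐ[ℂ] InductiveLimit Φ where
  toFun b := Subtype.mk (CStarQuotient.mk (nullIdeal B) (bseq Φ n b))
    (StarSubalgebra.le_topologicalClosure _ ⟨_, bseq_mem Φ n b, rfl⟩)
  map_one' := by
    refine Subtype.ext ((mk_eq_mk (y := 1) n ?_).trans (map_one _))
    refine seq_ind n (seq_self Φ n _) fun m hm ih => ?_
    exact (seq_succ Φ hm _).trans ((congrArg (Φ m) ih).trans (map_one (Φ m)))
  map_mul' b c := by
    refine Subtype.ext ((mk_eq_mk (y := bseq Φ n b * bseq Φ n c) n ?_).trans (map_mul _ _ _))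
    refine seq_ind n ?_ fun m hm ih => ?_
    · change seq Φ n _ n = seq Φ n _ n * seq Φ n _ n
      simp only [seq_self]
    · change seq Φ n _ (m + 1) = seq Φ n _ (m + 1) * seq Φ n _ (m + 1)
      simp only [seq_succ Φ hm]
      exact (congrArg (Φ m) ih).trans (map_mul (Φ m) _ _)
  map_zero' := by
    refine Subtype.ext ((mk_eq_mk (y := 0) n ?_).trans (map_zero _))
    refine seq_ind n (seq_self Φ n _) fun m hm ih => ?_
    exact (seq_succ Φ hm _).trans ((congrArg (Φ m) ih).trans (map_zero (Φ m)))
  map_add' b c := by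
    refine Subtype.ext ((mk_eq_mk (y := bseq Φ n b + bseq Φ n c) n ?_).trans (map_add _ _ _))
    refine seq_ind n ?_ fun m hm ih => ?_
    · change seq Φ n _ n = seq Φ n _ n + seq Φ n _ n
      simp only [seq_self]
    · change seq Φ n _ (m + 1) = seq Φ n _ (m + 1) + seq Φ n _ (m + 1)
      simp only [seq_succ Φ hm]
      exact (congrArg (Φ m) ih).trans (map_add (Φ m) _ _)
  commutes' c := by
    refine Subtype.ext ((mk_eq_mk (y := algebraMap ℂ _ c) n ?_).trans (AlgHomClass.commutes _ _))
    refine seq_ind n ?_ fun m hm ih => ?_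
    · refine (seq_self Φ n _).trans ?_
      simp [Algebra.algebraMap_eq_smul_one]
    · refine (seq_succ Φ hm _).trans ((congrArg (Φ m) ih).trans ?_)
      simp [Algebra.algebraMap_eq_smul_one]
  map_star' b := by
    refine Subtype.ext ((mk_eq_mk (y := star (bseq Φ n b)) n ?_).trans (map_star _ _))
    refine seq_ind n ?_ fun m hm ih => ?_
    · change seq Φ n _ n = star (seq Φ n _ n)
      simp only [seq_self]
    · change seq Φ n _ (m + 1) = star (seq Φ n _ (m + 1))
      simp only [seq_succ Φ hm]
      exact (congrArg (Φ m) ih).trans (map_star (Φ m) _)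

/-- The canonical maps are compatible with the connecting maps. -/
theorem of_succ (n : ℕ) (b : B n) : of Φ (n + 1) (Φ n b) = of Φ n b := by
  refine Subtype.ext (mk_eq_mk (n + 1) ?_)
  refine seq_ind (n + 1) ?_ fun m hm ih => ?_
  · exact (seq_self Φ (n + 1) _).trans
      ((congrArg (Φ n) (seq_self Φ n b).symm).trans (seq_succ Φ le_rfl b).symm)
  · exact (seq_succ Φ hm _).trans
      ((congrArg (Φ m) ih).trans (seq_succ Φ ((Nat.le_succ n).trans hm) b).symm)

end InductiveLimit

end InductiveLimit

/-! ## Conditional expectations and the associated Hilbert modules -/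

section CondExpModule

set_option linter.unusedSectionVars false

variable {A : Type u} [CStarAlgebra A] [PartialOrder A] [StarOrderedRing A]

/-- A conditional expectation of `A` onto the subalgebra `R`: a positive linear idempotent map
with range `R` which is an `R`-bimodule map. -/
structure CondExp (R : StarSubalgebra ℂ A) extends A →ₗ[ℂ] A where
  map_mem' : ∀ a, toFun a ∈ R
  map_of_mem' : ∀ r ∈ R, toFun r = r
  map_mul_left' : ∀ r ∈ R, ∀ a, toFun (r * a) = r * toFun a
  map_mul_right' : ∀ a, ∀ r ∈ R, toFun (a * r) = toFun a * r
  map_nonneg' : ∀ a, 0 ≤ a → 0 ≤ toFun a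

namespace CondExp

variable {R : StarSubalgebra ℂ A}

noncomputable instance : CoeFun (CondExp R) (fun _ => A → A) := ⟨fun E => E.toLinearMap⟩

/-- A conditional expectation is faithful if it does not vanish on nonzero positive elements. -/
def Faithful (E : CondExp R) : Prop := ∀ a : A, 0 ≤ a → E a = 0 → a = 0

variable (E : CondExp R)

theorem map_mem (a : A) : E a ∈ R := E.map_mem' a
theorem map_of_mem {r : A} (hr : r ∈ R) : E r = r := E.map_of_mem' r hr
theorem map_mul_left {r : A} (hr : r ∈ R) (a : A) : E (r * a) = r * E a := E.map_mul_left' r hr a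
theorem map_mul_right (a : A) {r : A} (hr : r ∈ R) : E (a * r) = E a * r :=
  E.map_mul_right' a r hr
theorem map_nonneg {a : A} (ha : 0 ≤ a) : 0 ≤ E a := E.map_nonneg' a ha
theorem map_one : E 1 = 1 := E.map_of_mem R.one_mem

theorem map_le {a b : A} (h : a ≤ b) : E a ≤ E b := by
  have := E.map_nonneg (sub_nonneg.2 h)
  rwa [map_sub, sub_nonneg] at this

theorem map_algebraMap (t : ℝ) : E (algebraMap ℝ A t) = algebraMap ℝ A t :=
  E.map_of_mem (by
    rw [IsScalarTower.algebraMap_apply ℝ ℂ A]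
    exact R.algebraMap_mem _)

theorem map_isSelfAdjoint {a : A} (ha : IsSelfAdjoint a) : IsSelfAdjoint (E a) := by
  have h1 : 0 ≤ algebraMap ℝ A ‖a‖ - a := sub_nonneg.2 ha.le_algebraMap_norm_self
  have h2 := IsSelfAdjoint.of_nonneg (E.map_nonneg h1)
  rw [map_sub, map_algebraMap] at h2
  have h3 : IsSelfAdjoint (algebraMap ℝ A ‖a‖) := IsSelfAdjoint.algebraMap A (by rfl)
  simpa using h3.sub h2

theorem map_star (a : A) : E (star a) = star (E a) := by
  have h1 := E.map_isSelfAdjoint (realPart a).2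
  have h2 := E.map_isSelfAdjoint (imaginaryPart a).2
  have e : a = (realPart a : A) + Complex.I • (imaginaryPart a : A) :=
    (realPart_add_I_smul_imaginaryPart a).symm
  have e' : star a = (realPart a : A) - Complex.I • (imaginaryPart a : A) := by
    conv_lhs => rw [e]
    rw [star_add, star_smul, (realPart a).2.star_eq, (imaginaryPart a).2.star_eq]
    simp [sub_eq_add_neg]
  rw [e', map_sub, map_smul]
  conv_rhs => rw [e, map_add, map_smul, star_add, star_smul, h1.star_eq, h2.star_eq]
  simp [sub_eq_add_neg]

/-- The Cauchy-Schwarz inequality for `(a, b) ↦ E (a* b)`. -/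
theorem norm_sq_le (a b : A) :
    ‖E (star a * b)‖ ^ 2 ≤ ‖E (star a * a)‖ * ‖E (star b * b)‖ := by
  set s := ‖E (star a * a)‖ with hs
  set x := E (star a * b) with hx
  have hxm : x ∈ R := E.map_mem _
  have hsm : star x ∈ R := star_mem hxm
  have hxs : E (star b * a) = star x := by rw [hx, ← map_star, star_mul, star_star]
  have key : ∀ t : ℝ, 0 < t → (2 * t - t ^ 2 * s) • (star x * x) ≤ E (star b * b) := by
    intro t ht
    have h1 : 0 ≤ E (star (b - a * (t • x)) * (b - a * (t • x))) :=
      E.map_nonneg (star_mul_self_nonneg _)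
    have htx : t • x ∈ R := by
      have : t • x = (t : ℂ) • x := by simp
      rw [this]
      exact R.smul_mem hxm _
    have hst : star (t • x) ∈ R := star_mem htx
    have h2 : ∀ z : A, star (b - a * z) * (b - a * z)
        = star b * b - star b * a * z - star z * (star a * b)
          + star z * ((star a * a) * z) := by
      intro z
      rw [star_sub, star_mul]
      noncomm_ring
    rw [h2 (t • x), map_add, map_sub, map_sub, E.map_mul_right _ htx, E.map_mul_left hst,
      E.map_mul_left hst, E.map_mul_right _ htx, hxs, ← hx] at h1
    have h3 : star x * E (star a * a) * x ≤ s • (star x * x) := by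
      have := CStarAlgebra.star_left_conjugate_le_norm_smul (a := x) (b := E (star a * a))
        (hb := IsSelfAdjoint.of_nonneg (E.map_nonneg (star_mul_self_nonneg a)))
      exact this
    have h4 : star (t • x) * (E (star a * a) * (t • x)) ≤ (t ^ 2 * s) • (star x * x) := by
      have h5 : star (t • x) * (E (star a * a) * (t • x))
          = t ^ 2 • (star x * E (star a * a) * x) := by
        simp only [star_smul, star_trivial, smul_mul_assoc, mul_smul_comm, smul_smul, mul_assoc, sq]
      rw [h5, mul_smul]
      exact smul_le_smul_of_nonneg_left h3 (sq_nonneg t)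
    have h6 : star x * (t • x) = t • (star x * x) := mul_smul_comm _ _ _
    have h7 : star (t • x) * x = t • (star x * x) := by
      rw [star_smul, star_trivial, smul_mul_assoc]
    rw [h6, h7] at h1
    have h8 := h1.trans (add_le_add_right h4 _)
    rw [← sub_nonneg]
    convert! h8 using 1
    module
  refine le_of_forall_pos_le_add fun ε hε => ?_
  have hs0 : 0 ≤ s := norm_nonneg _
  have hB : 0 ≤ ‖E (star b * b)‖ := norm_nonneg _
  set δ := ε / (‖E (star b * b)‖ + 1) with hδ
  have hδ0 : 0 < δ := by positivity
  have h1 := key (s + δ)⁻¹ (by positivity)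
  have h2 : (s + δ)⁻¹ ≤ 2 * (s + δ)⁻¹ - (s + δ)⁻¹ ^ 2 * s := by
    have : (s + δ)⁻¹ ^ 2 * s ≤ (s + δ)⁻¹ := by
      rw [sq, mul_assoc]
      refine mul_le_of_le_one_right (by positivity) ?_
      rw [inv_mul_le_iff₀ (by positivity)]
      linarith
    linarith
  have h3 : (s + δ)⁻¹ • (star x * x) ≤ E (star b * b) :=
    (smul_le_smul_of_nonneg_right h2 (star_mul_self_nonneg x)).trans h1
  have h4 := CStarAlgebra.norm_le_norm_of_nonneg_of_le
    (smul_nonneg (by positivity) (star_mul_self_nonneg x)) h3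
  rw [norm_smul, CStarRing.norm_star_mul_self, Real.norm_of_nonneg (by positivity),
    inv_mul_le_iff₀ (by positivity)] at h4
  calc ‖x‖ ^ 2 = ‖x‖ * ‖x‖ := sq _
    _ ≤ (s + δ) * ‖E (star b * b)‖ := h4
    _ = s * ‖E (star b * b)‖ + ε * (‖E (star b * b)‖ / (‖E (star b * b)‖ + 1)) := by
        rw [hδ]; ring
    _ ≤ s * ‖E (star b * b)‖ + ε := by
        have : ‖E (star b * b)‖ / (‖E (star b * b)‖ + 1) ≤ 1 := by
          rw [div_le_one (by positivity)]
          linarith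
        have := mul_le_of_le_one_right hε.le this
        linarith

theorem star_mul_self_le (a : A) : star (E a) * E a ≤ E (star a * a) := by
  have hm : E a ∈ R := E.map_mem a
  have hsm : star (E a) ∈ R := star_mem hm
  have h1 : 0 ≤ E (star (a - E a) * (a - E a)) := E.map_nonneg (star_mul_self_nonneg _)
  have h2 : star (a - E a) * (a - E a)
      = star a * a - star a * E a - star (E a) * a + star (E a) * E a := by
    rw [star_sub]; noncomm_ring
  rw [h2, map_add, map_sub, map_sub, E.map_mul_right _ hm, E.map_mul_left hsm,
    E.map_mul_left hsm, E.map_of_mem hm, map_star] at h1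
  rw [← sub_nonneg]
  convert! h1 using 1
  abel

theorem norm_map_star_mul_self_le (a : A) : ‖E (star a * a)‖ ≤ ‖a‖ ^ 2 := by
  have h1 : E (star a * a) ≤ algebraMap ℝ A (‖a‖ ^ 2) := by
    rw [← E.map_algebraMap]
    exact E.map_le CStarAlgebra.star_mul_le_algebraMap_norm_sq
  refine (CStarAlgebra.norm_le_norm_of_nonneg_of_le
    (E.map_nonneg (star_mul_self_nonneg a)) h1).trans ?_
  rw [Algebra.algebraMap_eq_smul_one, norm_smul, Real.norm_of_nonneg (by positivity)]
  exact mul_le_of_le_one_right (by positivity) (BoundedProd.norm_one_le A)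

/-- A conditional expectation is contractive. -/
theorem norm_map_le (a : A) : ‖E a‖ ≤ ‖a‖ := by
  have h1 := CStarAlgebra.norm_le_norm_of_nonneg_of_le (star_mul_self_nonneg (E a))
    (E.star_mul_self_le a)
  rw [CStarRing.norm_star_mul_self, ← sq] at h1
  exact abs_le_of_sq_le_sq' (h1.trans (E.norm_map_star_mul_self_le a)) (norm_nonneg a) |>.2

/-- `E` as a bounded operator. -/
noncomputable def toCLM : A →L[ℂ] A :=
  E.toLinearMap.mkContinuous 1 fun a => by rw [one_mul]; exact E.norm_map_le a

@[simp] theorem toCLM_apply (a : A) : E.toCLM a = E a := rfl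

/-- `A` with the seminorm `‖a‖ = ‖E (a* a)‖^(1/2)`. -/
def Pre (_E : CondExp R) : Type u := A

namespace Pre

noncomputable instance : AddCommGroup (Pre E) := inferInstanceAs (AddCommGroup A)
noncomputable instance : Module ℂ (Pre E) := inferInstanceAs (Module ℂ A)

/-- The identity map of `A`. -/
noncomputable def of : A →ₗ[ℂ] Pre E := LinearMap.id

noncomputable def out : Pre E →ₗ[ℂ] A := LinearMap.id

@[simp] theorem of_out (x : Pre E) : of E (out E x) = x := rfl
@[simp] theorem out_of (a : A) : out E (of E a) = a := rfl

noncomputable instance : Norm (Pre E) := ⟨fun x => √‖E (star (out E x) * out E x)‖⟩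

theorem norm_def (x : Pre E) : ‖x‖ = √‖E (star (out E x) * out E x)‖ := rfl

theorem norm_sq (x : Pre E) : ‖x‖ ^ 2 = ‖E (star (out E x) * out E x)‖ := by
  rw [norm_def, Real.sq_sqrt (norm_nonneg _)]

theorem norm_map_le (x y : Pre E) : ‖E (star (out E x) * out E y)‖ ≤ ‖x‖ * ‖y‖ := by
  have h := E.norm_sq_le (out E x) (out E y)
  rw [← norm_sq, ← norm_sq, ← mul_pow] at h
  exact abs_le_of_sq_le_sq' h (mul_nonneg (Real.sqrt_nonneg _) (Real.sqrt_nonneg _)) |>.2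

theorem core : SeminormedSpace.Core ℂ (Pre E) where
  norm_nonneg _ := Real.sqrt_nonneg _
  norm_smul c x := by
    rw [norm_def, norm_def, map_smul, star_smul, smul_mul_smul_comm, map_smul, norm_smul,
      norm_mul, norm_star, Real.sqrt_mul (by positivity), Real.sqrt_mul_self (norm_nonneg _)]
  norm_triangle x y := by
    have h0 : (0 : ℝ) ≤ ‖x‖ + ‖y‖ := add_nonneg (Real.sqrt_nonneg _) (Real.sqrt_nonneg _)
    refine abs_le_of_sq_le_sq' ?_ h0 |>.2
    have h1 : star (out E (x + y)) * out E (x + y)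
        = star (out E x) * out E x + star (out E x) * out E y + star (out E y) * out E x
          + star (out E y) * out E y := by
      rw [map_add, star_add]; noncomm_ring
    rw [norm_sq, h1, map_add, map_add, map_add]
    have h2 := norm_add_le (E (star (out E x) * out E x) + E (star (out E x) * out E y)
      + E (star (out E y) * out E x)) (E (star (out E y) * out E y))
    have h3 := norm_add_le (E (star (out E x) * out E x) + E (star (out E x) * out E y))
      (E (star (out E y) * out E x))
    have h4 := norm_add_le (E (star (out E x) * out E x)) (E (star (out E x) * out E y))
    have h5 := norm_map_le E x y
    have h6 := norm_map_le E y x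
    have h7 := norm_sq E x
    have h8 := norm_sq E y
    nlinarith

noncomputable instance : SeminormedAddCommGroup (Pre E) := SeminormedAddCommGroup.ofCore (core E)
noncomputable instance : NormedSpace ℂ (Pre E) where
  norm_smul_le c x := ((core E).norm_smul c x).le

end Pre

/-- The Hilbert module of `E`: the completion of `A` under the `R`-valued inner product
`⟨a, b⟩ = E (a* b)`. -/
abbrev HilbertModule : Type u := UniformSpace.Completion (Pre E)

namespace HilbertModule

/-- The canonical map of `A` into its completion. -/
noncomputable def incl : A →ₗ[ℂ] HilbertModule E :=
  (UniformSpace.Completion.toComplₗᵢ (𝕜 := ℂ) (E := Pre E)).toLinearMap ∘ₗ Pre.of E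

theorem norm_incl (a : A) : ‖incl E a‖ = √‖E (star a * a)‖ :=
  UniformSpace.Completion.norm_coe (Pre.of E a)

theorem norm_incl_sq (a : A) : ‖incl E a‖ ^ 2 = ‖E (star a * a)‖ := by
  rw [norm_incl, Real.sq_sqrt (norm_nonneg _)]

theorem denseRange_incl : DenseRange (incl E) :=
  UniformSpace.Completion.denseRange_coe (α := Pre E)

variable {E}

@[elab_as_elim]
theorem induction {p : HilbertModule E → Prop} (ξ : HilbertModule E) (hc : IsClosed {ξ | p ξ})
    (h : ∀ a, p (incl E a)) : p ξ :=
  UniformSpace.Completion.induction_on ξ hc h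

variable (E) in
/-- The inner product on elements of `A`. -/
noncomputable def preInner : A →ₗ⋆[ℂ] A →ₗ[ℂ] A :=
  LinearMap.mk₂'ₛₗ (starRingEnd ℂ) (RingHom.id ℂ) (fun a b => E (star a * b))
    (fun a b c => by rw [star_add, add_mul, map_add])
    (fun c a b => by rw [star_smul, smul_mul_assoc, map_smul]; rfl)
    (fun a b c => by rw [mul_add, map_add])
    (fun c a b => by rw [mul_smul_comm, map_smul]; rfl)

theorem preInner_bound (a b : A) : ‖preInner E a b‖ ≤ ‖incl E a‖ * ‖incl E b‖ := by
  rw [norm_incl, norm_incl]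
  exact Pre.norm_map_le E (Pre.of E a) (Pre.of E b)

variable (E) in
/-- For `a : A` the functional `⟨a, ·⟩` on the completion. -/
noncomputable def innerLeft : A →ₗ⋆[ℂ] (HilbertModule E →L[ℂ] A) where
  toFun a := (preInner E a).extendOfNorm (incl E)
  map_add' a b := by
    refine LinearMap.extendOfNorm_unique (denseRange_incl E) (‖incl E a‖ + ‖incl E b‖) ?_ _ ?_
    · intro c
      rw [map_add, LinearMap.add_apply, add_mul]
      exact (norm_add_le _ _).trans (add_le_add (preInner_bound a c) (preInner_bound b c))
    · ext c
      simp [LinearMap.extendOfNorm_eq (denseRange_incl E) ⟨_, preInner_bound _⟩]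
  map_smul' c a := by
    refine LinearMap.extendOfNorm_unique (denseRange_incl E) (‖c‖ * ‖incl E a‖) ?_ _ ?_
    · intro b
      rw [map_smulₛₗ, LinearMap.smul_apply, norm_smul, mul_assoc, RCLike.norm_conj]
      exact mul_le_mul_of_nonneg_left (preInner_bound a b) (norm_nonneg c)
    · ext b
      simp [LinearMap.extendOfNorm_eq (denseRange_incl E) ⟨_, preInner_bound _⟩]

theorem innerLeft_bound (a : A) : ‖innerLeft E a‖ ≤ 1 * ‖incl E a‖ := by
  rw [one_mul]
  exact ContinuousLinearMap.opNorm_le_bound _ (norm_nonneg _) fun ξ =>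
    LinearMap.norm_extendOfNorm_apply_le (denseRange_incl E) _ (preInner_bound a) ξ

variable (E) in
/-- The inner product of the Hilbert module, extended by continuity from
`⟨incl a, incl b⟩ = E (a* b)`. -/
noncomputable def inner : HilbertModule E →L⋆[ℂ] HilbertModule E →L[ℂ] A :=
  (innerLeft E).extendOfNorm (incl E)

theorem inner_incl (a b : A) : inner E (incl E a) (incl E b) = E (star a * b) := by
  rw [inner, LinearMap.extendOfNorm_eq (denseRange_incl E) ⟨_, innerLeft_bound⟩]
  exact LinearMap.extendOfNorm_eq (denseRange_incl E) ⟨_, preInner_bound _⟩ b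

theorem norm_inner_le (ξ η : HilbertModule E) : ‖inner E ξ η‖ ≤ ‖ξ‖ * ‖η‖ := by
  refine (ContinuousLinearMap.le_opNorm _ _).trans ?_
  have h := LinearMap.norm_extendOfNorm_apply_le (denseRange_incl E) 1 innerLeft_bound ξ
  rw [one_mul] at h
  exact mul_le_mul_of_nonneg_right h (norm_nonneg η)

theorem continuous_inner {X : Type*} [TopologicalSpace X] {f g : X → HilbertModule E}
    (hf : Continuous f) (hg : Continuous g) : Continuous fun x => inner E (f x) (g x) :=
  ((inner E).continuous.comp hf).clm_apply hg

theorem star_inner (ξ η : HilbertModule E) : star (inner E ξ η) = inner E η ξ := by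
  refine induction ξ (isClosed_eq (continuous_inner continuous_id continuous_const).star
    (continuous_inner continuous_const continuous_id)) fun a => ?_
  refine induction η (isClosed_eq (continuous_inner continuous_const continuous_id).star
    (continuous_inner continuous_id continuous_const)) fun b => ?_
  rw [inner_incl, inner_incl, ← E.map_star, star_mul, star_star]

theorem inner_self_nonneg (ξ : HilbertModule E) : 0 ≤ inner E ξ ξ := by
  refine induction ξ (CStarAlgebra.isClosed_nonneg.preimage
    (f := fun ξ => inner E ξ ξ) (continuous_inner continuous_id continuous_id)) fun a => ?_
  rw [inner_incl]
  exact E.map_nonneg (star_mul_self_nonneg a)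

theorem norm_inner_self (ξ : HilbertModule E) : ‖inner E ξ ξ‖ = ‖ξ‖ ^ 2 := by
  refine induction ξ (isClosed_eq (continuous_inner continuous_id continuous_id).norm
    (continuous_norm.pow 2)) fun a => ?_
  rw [inner_incl, norm_incl_sq]

/-- The inner product takes its values in `R`. -/
theorem inner_mem (ξ η : HilbertModule E) : inner E ξ η ∈ R := by
  have h : E.toCLM (inner E ξ η) = inner E ξ η := by
    refine induction ξ (isClosed_eq (E.toCLM.continuous.comp (continuous_inner continuous_id continuous_const))
      (continuous_inner continuous_id continuous_const)) fun a => ?_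
    refine induction η (isClosed_eq (E.toCLM.continuous.comp (continuous_inner continuous_const continuous_id))
      (continuous_inner continuous_const continuous_id)) fun b => ?_
    rw [inner_incl, toCLM_apply, E.map_of_mem (E.map_mem _)]
  rw [← h]
  exact E.map_mem _

theorem ext_inner {ξ η : HilbertModule E} (h : ∀ ζ, inner E ζ ξ = inner E ζ η) : ξ = η := by
  have h1 := norm_inner_self (ξ - η)
  rw [map_sub (inner E (ξ - η)), h, sub_self, norm_zero] at h1
  exact sub_eq_zero.1 (norm_eq_zero.1 (pow_eq_zero_iff two_ne_zero |>.1 h1.symm))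


end HilbertModule

end CondExp

end CondExpModule

/-! ## Adjointable operators -/

section Adjointable

set_option linter.unusedSectionVars false

variable {A : Type u} [CStarAlgebra A] [PartialOrder A] [StarOrderedRing A]

namespace CondExp

variable {R : StarSubalgebra ℂ A} (E : CondExp R)

open HilbertModule

/-- The right multiplication by `r ∈ R` on the Hilbert module, `incl a ↦ incl (a * r)`. -/
noncomputable def HilbertModule.rightMul (r : R) : HilbertModule E →L[ℂ] HilbertModule E :=
  (incl E ∘ₗ LinearMap.mulRight ℂ (r : A)).extendOfNorm (incl E)

theorem HilbertModule.rightMul_incl (r : R) (a : A) :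
    rightMul E r (incl E a) = incl E (a * r) := by
  refine LinearMap.extendOfNorm_eq (denseRange_incl E) ⟨‖(r : A)‖, fun b => ?_⟩ a
  refine abs_le_of_sq_le_sq' ?_ (by positivity) |>.2
  have h : star (b * (r : A)) * (b * r) = star (r : A) * (star b * b * r) := by
    rw [star_mul]; noncomm_ring
  simp only [LinearMap.comp_apply, LinearMap.mulRight_apply]
  rw [mul_pow, norm_incl_sq, norm_incl_sq, h, E.map_mul_left (star_mem r.2),
    E.map_mul_right _ r.2]
  refine (norm_mul_le _ _).trans ?_
  rw [norm_star]
  have := norm_mul_le (E (star b * b)) (r : A)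
  nlinarith [norm_nonneg (r : A)]

/-- `⟨ξ, η r⟩ = ⟨ξ, η⟩ r`. -/
theorem HilbertModule.inner_rightMul (r : R) (ξ η : HilbertModule E) :
    HilbertModule.inner E ξ (rightMul E r η) = HilbertModule.inner E ξ η * r := by
  refine HilbertModule.induction ξ (isClosed_eq (continuous_inner continuous_id continuous_const)
    ((continuous_inner continuous_id continuous_const).mul continuous_const)) fun a => ?_
  refine HilbertModule.induction η (isClosed_eq (continuous_inner continuous_const (rightMul E r).continuous)
    ((continuous_inner continuous_const continuous_id).mul continuous_const)) fun b => ?_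
  rw [rightMul_incl, inner_incl, inner_incl, ← mul_assoc, E.map_mul_right _ r.2]

theorem HilbertModule.inner_ext_left {ξ η : HilbertModule E}
    (h : ∀ ζ, HilbertModule.inner E ξ ζ = HilbertModule.inner E η ζ) : ξ = η := by
  refine ext_inner fun ζ => ?_
  rw [← star_inner ξ ζ, h, star_inner]

/-- The algebra of adjointable operators `T` on the Hilbert module of `E`: there is an operator `S`
with `⟨T ξ, η⟩ = ⟨ξ, S η⟩` for all `ξ, η`. -/
noncomputable def adjointableSubalgebra :
    Subalgebra ℂ (HilbertModule E →L[ℂ] HilbertModule E) where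
  carrier := {T | ∃ S : HilbertModule E →L[ℂ] HilbertModule E,
    ∀ ξ η, HilbertModule.inner E (T ξ) η = HilbertModule.inner E ξ (S η)}
  mul_mem' := by
    rintro T T' ⟨S, hS⟩ ⟨S', hS'⟩
    exact ⟨S' * S, fun ξ η => by
      change HilbertModule.inner E (T (T' ξ)) η = HilbertModule.inner E ξ (S' (S η))
      rw [hS, hS']⟩
  add_mem' := by
    rintro T T' ⟨S, hS⟩ ⟨S', hS'⟩
    exact ⟨S + S', fun ξ η => by simp [hS, hS']⟩
  algebraMap_mem' c := ⟨algebraMap ℂ _ (starRingEnd ℂ c), fun ξ η => by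
    simp [Algebra.algebraMap_eq_smul_one]⟩

/-- The adjointable operators on the Hilbert module of `E`, as a subtype of the bounded ones. -/
abbrev AdjSub : Type u := adjointableSubalgebra E

namespace AdjSub

variable {E}

/-- The adjoint of an adjointable operator. -/
noncomputable instance : Star (AdjSub E) where
  star T := ⟨T.2.choose, T.1, fun ξ η => by
    rw [← star_inner, ← T.2.choose_spec, star_inner]⟩

theorem inner_star_right (T : AdjSub E) (ξ η : HilbertModule E) :
    HilbertModule.inner E ξ ((star T).1 η) = HilbertModule.inner E (T.1 ξ) η :=
  (T.2.choose_spec ξ η).symm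

theorem inner_star_left (T : AdjSub E) (ξ η : HilbertModule E) :
    HilbertModule.inner E ((star T).1 ξ) η = HilbertModule.inner E ξ (T.1 η) := by
  rw [← star_inner, inner_star_right, star_inner]

/-- An adjointable operator with adjoint `S` has `star T = S`. -/
theorem star_eq {T S : AdjSub E}
    (h : ∀ ξ η, HilbertModule.inner E (T.1 ξ) η = HilbertModule.inner E ξ (S.1 η)) :
    star T = S :=
  Subtype.ext (ContinuousLinearMap.ext fun η => ext_inner fun ξ => by
    rw [inner_star_right, h])

noncomputable instance : StarRing (AdjSub E) where
  star_involutive T := star_eq fun ξ η => inner_star_left T ξ η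
  star_mul T T' := star_eq fun ξ η => by
    change HilbertModule.inner E (T.1 (T'.1 ξ)) η
      = HilbertModule.inner E ξ ((star T').1 ((star T).1 η))
    rw [inner_star_right, inner_star_right]
  star_add T T' := star_eq fun ξ η => by
    change HilbertModule.inner E (T.1 ξ + T'.1 ξ) η
      = HilbertModule.inner E ξ ((star T).1 η + (star T').1 η)
    rw [map_add, map_add, inner_star_right, inner_star_right]
    rfl

instance : StarModule ℂ (AdjSub E) where
  star_smul c T := star_eq fun ξ η => by
    change HilbertModule.inner E (c • T.1 ξ) η = HilbertModule.inner E ξ (star c • (star T).1 η)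
    rw [map_smulₛₗ, map_smul, inner_star_right]
    rfl

instance : CStarRing (AdjSub E) where
  norm_mul_self_le T := by
    have h1 : ‖T.1‖ ≤ √‖(star T * T).1‖ := by
      refine ContinuousLinearMap.opNorm_le_bound _ (Real.sqrt_nonneg _) fun ξ => ?_
      refine abs_le_of_sq_le_sq' ?_ (by positivity) |>.2
      rw [mul_pow, Real.sq_sqrt (norm_nonneg _), ← norm_inner_self, ← inner_star_right]
      refine (norm_inner_le _ _).trans ?_
      have h2 := (star T * T).1.le_opNorm ξ
      have h3 : (star T * T).1 ξ = (star T).1 (T.1 ξ) := rfl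
      rw [h3] at h2
      nlinarith [norm_nonneg ξ]
    calc ‖T‖ * ‖T‖ ≤ √‖(star T * T).1‖ * √‖(star T * T).1‖ := by
          exact mul_le_mul h1 h1 (norm_nonneg _) (Real.sqrt_nonneg _)
      _ = ‖star T * T‖ := Real.mul_self_sqrt (norm_nonneg _)

theorem isClosed : 
    IsClosed (adjointableSubalgebra E : Set (HilbertModule E →L[ℂ] HilbertModule E)) := by
  refine isClosed_of_closure_subset fun T hT => ?_
  obtain ⟨x, hx, hlim⟩ := mem_closure_iff_seq_limit.1 hT
  set y : ℕ → AdjSub E := fun k => ⟨x k, hx k⟩ with hy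
  have hyc : CauchySeq y := by
    have := hlim.cauchySeq
    rw [Metric.cauchySeq_iff] at this ⊢
    exact this
  have hsc : CauchySeq fun k => (star (y k)).1 := by
    rw [Metric.cauchySeq_iff] at hyc ⊢
    intro ε hε
    obtain ⟨N, hN⟩ := hyc ε hε
    refine ⟨N, fun m hm n hn => ?_⟩
    have h := hN m hm n hn
    rw [dist_eq_norm] at h ⊢
    have hns : ‖star (y m - y n)‖ = ‖y m - y n‖ :=
      @norm_star _ _ _ CStarRing.to_normedStarGroup (y m - y n)
    have h' := hns.trans_lt h
    rw [star_sub] at h'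
    exact h'
  obtain ⟨S, hS⟩ := cauchySeq_tendsto_of_complete hsc
  refine ⟨S, fun ξ η => ?_⟩
  have l1 : Tendsto (fun k => HilbertModule.inner E (x k ξ) η) atTop
      (𝓝 (HilbertModule.inner E (T ξ) η)) := by
    have hc : Continuous fun U : HilbertModule E →L[ℂ] HilbertModule E =>
      HilbertModule.inner E (U ξ) η :=
      continuous_inner (ContinuousLinearMap.apply ℂ _ ξ).continuous continuous_const
    exact (hc.tendsto T).comp hlim
  have l2 : Tendsto (fun k => HilbertModule.inner E ξ ((star (y k)).1 η)) atTop
      (𝓝 (HilbertModule.inner E ξ (S η))) := by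
    have hc : Continuous fun U : HilbertModule E →L[ℂ] HilbertModule E =>
      HilbertModule.inner E ξ (U η) :=
      continuous_inner continuous_const (ContinuousLinearMap.apply ℂ _ η).continuous
    exact (hc.tendsto S).comp hS
  refine tendsto_nhds_unique l1 (l2.congr fun k => ?_)
  rw [inner_star_right]

instance : CompleteSpace (AdjSub E) :=
  completeSpace_coe_iff_isComplete.2 (isClosed (E := E)).isComplete

/-- The adjointable operators form a unital C*-algebra with the operator norm. -/
noncomputable instance instCStarAlgebra : CStarAlgebra (AdjSub E) where

end AdjSub

/-- The C*-algebra of adjointable operators on the Hilbert module of `E`. -/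
def Adjointable : Type u := AdjSub E

namespace Adjointable

noncomputable instance instCStarAlgebra : CStarAlgebra (Adjointable E) :=
  inferInstanceAs (CStarAlgebra (AdjSub E))

variable {E}

/-- The bounded operator underlying an adjointable operator. -/
def toCLM (T : Adjointable E) : HilbertModule E →L[ℂ] HilbertModule E := Subtype.val T

/-- An operator `T` with adjoint `S`, as an adjointable operator. -/
def mk (T S : HilbertModule E →L[ℂ] HilbertModule E)
    (h : ∀ ξ η, HilbertModule.inner E (T ξ) η = HilbertModule.inner E ξ (S η)) : Adjointable E :=
  Subtype.mk T ⟨S, h⟩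

theorem ext {T S : Adjointable E} (h : T.toCLM = S.toCLM) : T = S := Subtype.ext h

theorem inner_star_right (T : Adjointable E) (ξ η : HilbertModule E) :
    HilbertModule.inner E ξ ((star T).toCLM η) = HilbertModule.inner E (T.toCLM ξ) η :=
  AdjSub.inner_star_right T ξ η

theorem inner_star_left (T : Adjointable E) (ξ η : HilbertModule E) :
    HilbertModule.inner E ((star T).toCLM ξ) η = HilbertModule.inner E ξ (T.toCLM η) :=
  AdjSub.inner_star_left T ξ η

theorem star_eq {T S : Adjointable E}
    (h : ∀ ξ η, HilbertModule.inner E (T.toCLM ξ) η = HilbertModule.inner E ξ (S.toCLM η)) :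
    star T = S :=
  AdjSub.star_eq h

theorem star_mk (T S : HilbertModule E →L[ℂ] HilbertModule E)
    (h : ∀ ξ η, HilbertModule.inner E (T ξ) η = HilbertModule.inner E ξ (S η))
    (U : HilbertModule E →L[ℂ] HilbertModule E)
    (h' : ∀ ξ η, HilbertModule.inner E (S ξ) η = HilbertModule.inner E ξ (U η)) :
    star (mk T S h) = mk S U h' :=
  star_eq h

theorem toCLM_smul (c : ℂ) (T : Adjointable E) : (c • T).toCLM = c • T.toCLM := rfl

theorem toCLM_algebraMap (c : ℂ) (ξ : HilbertModule E) :
    (algebraMap ℂ (Adjointable E) c).toCLM ξ = c • ξ := rfl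

/-- Adjointable operators are right `R`-linear. -/
theorem apply_rightMul (T : Adjointable E) (r : R) (ξ : HilbertModule E) :
    T.toCLM (rightMul E r ξ) = rightMul E r (T.toCLM ξ) := by
  refine ext_inner fun ζ => ?_
  rw [inner_rightMul, ← inner_star_left, inner_rightMul, inner_star_left]

/-- `⟨T ξ, T ξ⟩ ≤ ‖T‖² ⟨ξ, ξ⟩`. -/
theorem inner_apply_le (T : Adjointable E) (ξ : HilbertModule E) :
    HilbertModule.inner E (T.toCLM ξ) (T.toCLM ξ) ≤ ‖T‖ ^ 2 • HilbertModule.inner E ξ ξ := by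
  let _ := CStarAlgebra.spectralOrder (Adjointable E)
  have := CStarAlgebra.spectralOrderedRing (Adjointable E)
  have h1 : 0 ≤ algebraMap ℝ (Adjointable E) (‖T‖ ^ 2) - star T * T :=
    sub_nonneg.2 CStarAlgebra.star_mul_le_algebraMap_norm_sq
  obtain ⟨S, hS⟩ := CStarAlgebra.nonneg_iff_eq_star_mul_self.1 h1
  have h2 : (algebraMap ℝ (Adjointable E) (‖T‖ ^ 2)).toCLM ξ
      = (star T).toCLM (T.toCLM ξ) + (star S).toCLM (S.toCLM ξ) := by
    rw [sub_eq_iff_eq_add'] at hS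
    rw [hS]
    rfl
  have h3 : (algebraMap ℝ (Adjointable E) (‖T‖ ^ 2)).toCLM ξ = ((‖T‖ ^ 2 : ℝ) : ℂ) • ξ := by
    rw [IsScalarTower.algebraMap_apply ℝ ℂ (Adjointable E), Algebra.algebraMap_eq_smul_one]
    rfl
  have h4 := congrArg (HilbertModule.inner E ξ) (h3.symm.trans h2)
  rw [map_add, inner_star_right, inner_star_right, map_smul] at h4
  have h5 := inner_self_nonneg (S.toCLM ξ)
  have h6 : ‖T‖ ^ 2 • HilbertModule.inner E ξ ξ
      = ((‖T‖ ^ 2 : ℝ) : ℂ) • HilbertModule.inner E ξ ξ :=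
    RCLike.real_smul_eq_coe_smul (K := ℂ) _ _
  rw [h6, h4]
  exact le_add_of_nonneg_right h5

end Adjointable

/-! ### The left action of `A` and the projection defined by `E` -/

theorem norm_incl_mul_le (a x : A) : ‖incl E (a * x)‖ ≤ ‖a‖ * ‖incl E x‖ := by
  refine abs_le_of_sq_le_sq' ?_ (by positivity) |>.2
  have h1 : star (a * x) * (a * x) ≤ ‖a‖ ^ 2 • (star x * x) := by
    have h2 : star (a * x) * (a * x) = star x * (star a * a) * x := by
      rw [star_mul]; noncomm_ring
    have h3 := star_left_conjugate_le_conjugate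
      (CStarAlgebra.star_mul_le_algebraMap_norm_sq (a := a)) x
    rw [h2]
    refine h3.trans_eq ?_
    rw [Algebra.algebraMap_eq_smul_one]
    simp
  have h4 := E.map_le h1
  have h5 : E (‖a‖ ^ 2 • (star x * x)) = ‖a‖ ^ 2 • E (star x * x) :=
    LinearMap.map_smul_of_tower E.toLinearMap (‖a‖ ^ 2) (star x * x)
  have h6 := CStarAlgebra.norm_le_norm_of_nonneg_of_le
    (E.map_nonneg (star_mul_self_nonneg (a * x))) h4
  rwa [h5, norm_smul, Real.norm_of_nonneg (by positivity), ← norm_incl_sq, ← norm_incl_sq,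
    ← mul_pow] at h6

/-- The continuous extension of `incl x ↦ incl (a * x)`. -/
noncomputable def leftMulCLM (a : A) : HilbertModule E →L[ℂ] HilbertModule E :=
  (incl E ∘ₗ LinearMap.mulLeft ℂ a).extendOfNorm (incl E)

theorem leftMulCLM_incl (a x : A) : leftMulCLM E a (incl E x) = incl E (a * x) :=
  LinearMap.extendOfNorm_eq (denseRange_incl E) ⟨‖a‖, norm_incl_mul_le E a⟩ x

theorem inner_leftMulCLM (a : A) (ξ η : HilbertModule E) :
    HilbertModule.inner E (leftMulCLM E a ξ) η
      = HilbertModule.inner E ξ (leftMulCLM E (star a) η) := by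
  refine HilbertModule.induction ξ (isClosed_eq (continuous_inner (leftMulCLM E a).continuous continuous_const)
    (continuous_inner continuous_id continuous_const)) fun x => ?_
  refine HilbertModule.induction η (isClosed_eq (continuous_inner continuous_const continuous_id)
    (continuous_inner continuous_const (leftMulCLM E (star a)).continuous)) fun y => ?_
  rw [leftMulCLM_incl, leftMulCLM_incl, inner_incl, inner_incl, star_mul, mul_assoc]

/-- Two bounded operators on the Hilbert module that agree on `incl A` are equal. -/
theorem clm_ext {F : Type*} [NormedAddCommGroup F] [NormedSpace ℂ F]
    {T S : HilbertModule E →L[ℂ] F}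
    (h : ∀ x, T (incl E x) = S (incl E x)) : T = S :=
  ContinuousLinearMap.ext fun ξ =>
    HilbertModule.induction ξ (isClosed_eq T.continuous S.continuous) h

/-- The left action of `A` on the Hilbert module: `leftMul E a` extends `incl x ↦ incl (a * x)`. -/
noncomputable def leftMul : A →⋆ₐ[ℂ] Adjointable E where
  toFun a := Adjointable.mk (leftMulCLM E a) (leftMulCLM E (star a)) (inner_leftMulCLM E a)
  map_one' := Adjointable.ext (clm_ext E fun x => (leftMulCLM_incl E 1 x).trans (by rw [one_mul]; rfl))
  map_mul' a b := Adjointable.ext (clm_ext E fun x => by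
    change leftMulCLM E (a * b) (incl E x) = leftMulCLM E a (leftMulCLM E b (incl E x))
    rw [leftMulCLM_incl, leftMulCLM_incl, leftMulCLM_incl, mul_assoc])
  map_zero' := Adjointable.ext (clm_ext E fun x =>
    (leftMulCLM_incl E 0 x).trans (by rw [zero_mul, map_zero]; rfl))
  map_add' a b := Adjointable.ext (clm_ext E fun x => by
    change leftMulCLM E (a + b) (incl E x) = leftMulCLM E a (incl E x) + leftMulCLM E b (incl E x)
    rw [leftMulCLM_incl, leftMulCLM_incl, leftMulCLM_incl, add_mul, map_add])
  commutes' c := Adjointable.ext (clm_ext E fun x => (leftMulCLM_incl E _ x).trans (by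
    rw [Algebra.algebraMap_eq_smul_one, smul_mul_assoc, one_mul, map_smul]
    rfl))
  map_star' a := (Adjointable.star_mk _ _ (inner_leftMulCLM E a) _ (inner_leftMulCLM E (star a))).symm

theorem leftMul_incl (a x : A) : (leftMul E a).toCLM (incl E x) = incl E (a * x) :=
  leftMulCLM_incl E a x

theorem norm_incl_map_le (x : A) : ‖incl E (E x)‖ ≤ 1 * ‖incl E x‖ := by
  rw [one_mul]
  refine abs_le_of_sq_le_sq' ?_ (norm_nonneg _) |>.2
  rw [norm_incl_sq, norm_incl_sq]
  refine CStarAlgebra.norm_le_norm_of_nonneg_of_le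
    (E.map_nonneg (star_mul_self_nonneg _)) ?_
  rw [E.map_of_mem (mul_mem (star_mem (E.map_mem x)) (E.map_mem x))]
  exact E.star_mul_self_le x

/-- The continuous extension of `incl x ↦ incl (E x)`. -/
noncomputable def projCLM : HilbertModule E →L[ℂ] HilbertModule E :=
  (incl E ∘ₗ E.toLinearMap).extendOfNorm (incl E)

theorem projCLM_incl (x : A) : projCLM E (incl E x) = incl E (E x) :=
  LinearMap.extendOfNorm_eq (denseRange_incl E) ⟨1, norm_incl_map_le E⟩ x

theorem inner_projCLM (ξ η : HilbertModule E) :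
    HilbertModule.inner E (projCLM E ξ) η = HilbertModule.inner E ξ (projCLM E η) := by
  refine HilbertModule.induction ξ (isClosed_eq (continuous_inner (projCLM E).continuous continuous_const)
    (continuous_inner continuous_id continuous_const)) fun x => ?_
  refine HilbertModule.induction η (isClosed_eq (continuous_inner continuous_const continuous_id)
    (continuous_inner continuous_const (projCLM E).continuous)) fun y => ?_
  rw [projCLM_incl, projCLM_incl, inner_incl, inner_incl, E.map_mul_left (star_mem (E.map_mem x)),
    E.map_mul_right _ (E.map_mem y), E.map_star]

/-- The projection on the Hilbert module that extends `incl x ↦ incl (E x)`. -/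
noncomputable def proj : Adjointable E := 
  Adjointable.mk (projCLM E) (projCLM E) (inner_projCLM E)

theorem proj_incl (x : A) : (proj E).toCLM (incl E x) = incl E (E x) := projCLM_incl E x

/-! ### The connecting maps -/

variable {E} {R' : StarSubalgebra ℂ A} {E' : CondExp R'}

theorem norm_incl_le_of_comp (h : ∀ a, E' (E a) = E' a) (a : A) : ‖incl E' a‖ ≤ 1 * ‖incl E a‖ := by
  rw [one_mul]
  refine abs_le_of_sq_le_sq' ?_ (norm_nonneg _) |>.2
  rw [norm_incl_sq, norm_incl_sq, ← h]
  exact E'.norm_map_le _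

variable (E E') in
/-- The map between the Hilbert modules that extends `incl a ↦ incl a`. -/
noncomputable def conn : HilbertModule E →L[ℂ] HilbertModule E' :=
  (incl E').extendOfNorm (incl E)

theorem conn_incl (h : ∀ a, E' (E a) = E' a) (a : A) : conn E E' (incl E a) = incl E' a :=
  LinearMap.extendOfNorm_eq (denseRange_incl E) ⟨1, norm_incl_le_of_comp h⟩ a

theorem inner_conn (h : ∀ a, E' (E a) = E' a) (ξ η : HilbertModule E) :
    HilbertModule.inner E' (conn E E' ξ) (conn E E' η) = E'.toCLM (HilbertModule.inner E ξ η) := by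
  refine HilbertModule.induction ξ (isClosed_eq (continuous_inner (conn E E').continuous continuous_const)
    (E'.toCLM.continuous.comp (continuous_inner continuous_id continuous_const))) fun a => ?_
  refine HilbertModule.induction η (isClosed_eq (continuous_inner continuous_const (conn E E').continuous)
    (E'.toCLM.continuous.comp (continuous_inner continuous_const continuous_id))) fun b => ?_
  rw [conn_incl h, conn_incl h, inner_incl, inner_incl, toCLM_apply, h]

theorem norm_conn_apply_le (h : ∀ a, E' (E a) = E' a) (T : Adjointable E) (ξ : HilbertModule E) :
    ‖conn E E' (T.toCLM ξ)‖ ≤ ‖T‖ * ‖conn E E' ξ‖ := by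
  refine abs_le_of_sq_le_sq' ?_ (by positivity) |>.2
  have h1 := E'.map_le (Adjointable.inner_apply_le T ξ)
  have h2 := E'.map_nonneg (inner_self_nonneg (T.toCLM ξ))
  have h3 : E' (‖T‖ ^ 2 • HilbertModule.inner E ξ ξ) = ‖T‖ ^ 2 • E' (HilbertModule.inner E ξ ξ) :=
    LinearMap.map_smul_of_tower E'.toLinearMap (‖T‖ ^ 2) _
  have h4 := CStarAlgebra.norm_le_norm_of_nonneg_of_le h2 h1
  rw [h3, norm_smul, Real.norm_of_nonneg (by positivity), ← toCLM_apply, ← toCLM_apply,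
    ← inner_conn h, ← inner_conn h, norm_inner_self, norm_inner_self] at h4
  rw [mul_pow]
  exact h4

variable (E') in
/-- For an adjointable `T` on the Hilbert module of `E`, the operator on the Hilbert module of `E'`
with `conn ξ ↦ conn (T ξ)`. -/
noncomputable def connOpCLM (T : Adjointable E) : HilbertModule E' →L[ℂ] HilbertModule E' :=
  ((conn E E').toLinearMap ∘ₗ T.toCLM.toLinearMap ∘ₗ incl E).extendOfNorm (incl E')

theorem connOpCLM_conn (h : ∀ a, E' (E a) = E' a) (T : Adjointable E) (ξ : HilbertModule E) :
    connOpCLM E' T (conn E E' ξ) = conn E E' (T.toCLM ξ) := by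
  refine HilbertModule.induction ξ (isClosed_eq
    ((connOpCLM E' T).continuous.comp (conn E E').continuous)
    ((conn E E').continuous.comp T.toCLM.continuous)) fun a => ?_
  rw [conn_incl h]
  refine LinearMap.extendOfNorm_eq (denseRange_incl E') ⟨‖T‖, fun b => ?_⟩ a
  have := norm_conn_apply_le h T (incl E b)
  rwa [conn_incl h] at this

/-- Bounded operators on the Hilbert module of `E'` that agree on the range of `conn` are equal. -/
theorem clm_ext_conn (h : ∀ a, E' (E a) = E' a) {T S : HilbertModule E' →L[ℂ] HilbertModule E'}
    (hTS : ∀ ξ, T (conn E E' ξ) = S (conn E E' ξ)) : T = S :=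
  clm_ext E' fun x => by rw [← conn_incl h, hTS]

theorem inner_connOpCLM (h : ∀ a, E' (E a) = E' a) (T : Adjointable E)
    (ξ η : HilbertModule E') :
    HilbertModule.inner E' (connOpCLM E' T ξ) η
      = HilbertModule.inner E' ξ (connOpCLM E' (star T) η) := by
  refine HilbertModule.induction ξ (isClosed_eq (continuous_inner (connOpCLM E' T).continuous continuous_const)
    (continuous_inner continuous_id continuous_const)) fun x => ?_
  refine HilbertModule.induction η (isClosed_eq (continuous_inner continuous_const continuous_id)
    (continuous_inner continuous_const (connOpCLM E' (star T)).continuous)) fun y => ?_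
  rw [← conn_incl h, ← conn_incl h, connOpCLM_conn h, connOpCLM_conn h, inner_conn h,
    inner_conn h, Adjointable.inner_star_right]

/-- The connecting *-homomorphism `Φ` between the algebras of adjointable operators, with
`Φ T (conn ξ) = conn (T ξ)`. -/
noncomputable def connOp (h : ∀ a, E' (E a) = E' a) : Adjointable E →⋆ₐ[ℂ] Adjointable E' where
  toFun T := Adjointable.mk (connOpCLM E' T) (connOpCLM E' (star T)) (inner_connOpCLM h T)
  map_one' := Adjointable.ext (clm_ext_conn h fun ξ => connOpCLM_conn h 1 ξ)
  map_mul' T S := Adjointable.ext (clm_ext_conn h fun ξ => by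
    change connOpCLM E' (T * S) _ = connOpCLM E' T (connOpCLM E' S _)
    rw [connOpCLM_conn h, connOpCLM_conn h, connOpCLM_conn h]
    rfl)
  map_zero' := Adjointable.ext (clm_ext_conn h fun ξ =>
    (connOpCLM_conn h 0 ξ).trans (map_zero (conn E E')))
  map_add' T S := Adjointable.ext (clm_ext_conn h fun ξ => by
    change connOpCLM E' (T + S) _ = connOpCLM E' T _ + connOpCLM E' S _
    rw [connOpCLM_conn h, connOpCLM_conn h, connOpCLM_conn h, ← map_add]
    rfl)
  commutes' c := Adjointable.ext (clm_ext_conn h fun ξ => by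
    refine (connOpCLM_conn h _ ξ).trans ?_
    simp only [Algebra.algebraMap_eq_smul_one]
    exact map_smul (conn E E') c ξ)
  map_star' T := (Adjointable.star_mk _ _ (inner_connOpCLM h T) _
    (inner_connOpCLM h (star T))).symm

theorem connOp_conn (h : ∀ a, E' (E a) = E' a) (T : Adjointable E) (ξ : HilbertModule E) :
    (connOp h T).toCLM (conn E E' ξ) = conn E E' (T.toCLM ξ) := connOpCLM_conn h T ξ

end CondExp

end Adjointable

/-! ## Approximately proper equivalence relations and their C*-algebras -/

section ApproximatelyProper

set_option linter.unusedSectionVars false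

variable {A : Type u} [CStarAlgebra A] [PartialOrder A] [StarOrderedRing A]

/-- An approximately proper equivalence relation on a unital C*-algebra `A`: a decreasing sequence
of closed unital *-subalgebras, starting with `A`. -/
structure ApproxProper (A : Type u) [CStarAlgebra A] where
  R : ℕ → StarSubalgebra ℂ A
  isClosed : ∀ n, IsClosed (R n : Set A)
  succ_le : ∀ n, R (n + 1) ≤ R n
  zero_eq : R 0 = ⊤

/-- A sequence of faithful conditional expectations `E n` of `A` onto `R n` with
`E (n + 1) ∘ E n = E (n + 1)`. -/
structure CondExpSeq (ℛ : ApproxProper A) where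
  E : ∀ n, CondExp (ℛ.R n)
  faithful : ∀ n, (E n).Faithful
  comp : ∀ n a, E (n + 1) (E n a) = E (n + 1) a

namespace CondExpSeq

variable {ℛ : ApproxProper A} (ℰ : CondExpSeq ℛ)

/-! ### The Toeplitz algebra -/

/-- A representation in the unital C*-algebra `B` of the generators and relations of the Toeplitz
algebra: a unital *-homomorphism `φ` of `A` and a sequence of projections `e n`. -/
structure ToeplitzRep (B : Type v) [CStarAlgebra B] where
  φ : A →⋆ₐ[ℂ] B
  e : ℕ → B
  isStarProjection : ∀ n, IsStarProjection (e n)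
  e_zero : e 0 = 1
  e_succ_mul : ∀ n, e (n + 1) * e n = e (n + 1)
  e_mul_mul : ∀ n a, e n * φ a * e n = φ (ℰ.E n a) * e n

/-- All representations of the generators and relations in C*-algebras of the universe of `A`.
These suffice: the C*-algebra generated by a representation is generated by a copy of a quotient of
`A` and a sequence, so it has a copy in the universe of `A`. -/
structure RepIndex : Type (u + 1) where
  B : Type u
  [inst : CStarAlgebra B]
  rep : ToeplitzRep ℰ B

instance (i : RepIndex ℰ) : CStarAlgebra i.B := i.inst

/-- The direct sum of all representations, on `A`. -/
noncomputable def univIncl : A →⋆ₐ[ℂ] BoundedProd (fun i : RepIndex ℰ => i.B) where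
  toFun a := BoundedProd.of (fun i => i.rep.φ a) ‖a‖
    fun i => NonUnitalStarAlgHom.norm_apply_le i.rep.φ a
  map_one' := BoundedProd.ext fun i => map_one i.rep.φ
  map_mul' a b := BoundedProd.ext fun i => map_mul i.rep.φ a b
  map_zero' := BoundedProd.ext fun i => map_zero i.rep.φ
  map_add' a b := BoundedProd.ext fun i => map_add i.rep.φ a b
  commutes' c := BoundedProd.ext fun i => by
    simp [Algebra.algebraMap_eq_smul_one]
  map_star' a := BoundedProd.ext fun i => map_star i.rep.φ a

/-- The direct sum of all representations, on the projections. -/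
noncomputable def univProj (n : ℕ) : BoundedProd (fun i : RepIndex ℰ => i.B) :=
  BoundedProd.of (fun i => i.rep.e n) 1 fun i => (i.rep.isStarProjection n).norm_le

/-- The C*-algebra generated by the direct sum of all representations. -/
noncomputable def toeplitzSubalgebra :
    StarSubalgebra ℂ (BoundedProd (fun i : RepIndex ℰ => i.B)) :=
  (StarAlgebra.adjoin ℂ (Set.range (univIncl ℰ) ∪ Set.range (univProj ℰ))).topologicalClosure

instance : IsClosed (toeplitzSubalgebra ℰ : Set (BoundedProd (fun i : RepIndex ℰ => i.B))) :=
  StarSubalgebra.isClosed_topologicalClosure _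

/-- The Toeplitz algebra: the universal C*-algebra generated by `A` and projections `ê n` with
`ê 0 = 1`, `ê (n + 1) ê n = ê (n + 1)` and `ê n a ê n = E n a ê n`. -/
def Toeplitz : Type (u + 1) := toeplitzSubalgebra ℰ

namespace Toeplitz

noncomputable instance : CStarAlgebra (Toeplitz ℰ) :=
  inferInstanceAs (CStarAlgebra (toeplitzSubalgebra ℰ))

/-- The canonical map of `A` into the Toeplitz algebra. -/
noncomputable def incl : A →⋆ₐ[ℂ] Toeplitz ℰ :=
  (univIncl ℰ).codRestrict (toeplitzSubalgebra ℰ) fun a => StarSubalgebra.le_topologicalClosure _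
    (StarAlgebra.subset_adjoin ℂ _ (Or.inl ⟨a, rfl⟩))

/-- The projections `ê n`. -/
noncomputable def ehat (n : ℕ) : Toeplitz ℰ :=
  Subtype.mk (univProj ℰ n) (StarSubalgebra.le_topologicalClosure _
    (StarAlgebra.subset_adjoin ℂ _ (Or.inr ⟨n, rfl⟩)))

/-- The canonical generators satisfy the relations. -/
noncomputable def univRep : ToeplitzRep ℰ (Toeplitz ℰ) where
  φ := incl ℰ
  e := ehat ℰ
  isStarProjection n :=
    ⟨Subtype.ext (BoundedProd.ext fun i => (i.rep.isStarProjection n).isIdempotentElem),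
      Subtype.ext (BoundedProd.ext fun i => (i.rep.isStarProjection n).isSelfAdjoint)⟩
  e_zero := Subtype.ext (BoundedProd.ext fun i => i.rep.e_zero)
  e_succ_mul n := Subtype.ext (BoundedProd.ext fun i => i.rep.e_succ_mul n)
  e_mul_mul n a := Subtype.ext (BoundedProd.ext fun i => i.rep.e_mul_mul n a)

/-- The universal property: every representation of the generators and relations extends to the
Toeplitz algebra. -/
noncomputable def lift {B : Type u} [CStarAlgebra B] (ρ : ToeplitzRep ℰ B) :
    Toeplitz ℰ →⋆ₐ[ℂ] B where
  toFun x := x.1 ⟨B, ρ⟩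
  map_one' := rfl
  map_mul' _ _ := rfl
  map_zero' := rfl
  map_add' _ _ := rfl
  commutes' c := by
    change (algebraMap ℂ (BoundedProd fun i : RepIndex ℰ => i.B) c) ⟨B, ρ⟩ = algebraMap ℂ B c
    simp [Algebra.algebraMap_eq_smul_one]
  map_star' _ := rfl

theorem lift_incl {B : Type u} [CStarAlgebra B] (ρ : ToeplitzRep ℰ B) (a : A) :
    lift ℰ ρ (incl ℰ a) = ρ.φ a := rfl

theorem lift_ehat {B : Type u} [CStarAlgebra B] (ρ : ToeplitzRep ℰ B) (n : ℕ) :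
    lift ℰ ρ (ehat ℰ n) = ρ.e n := rfl

/-- The closed linear span of the products `a ê n b`. -/
noncomputable def khat (n : ℕ) : Submodule ℂ (Toeplitz ℰ) :=
  (Submodule.span ℂ {x | ∃ a b : A, x = incl ℰ a * ehat ℰ n * incl ℰ b}).topologicalClosure

/-- `(k 0, …, k n)` is an `n`-redundancy. -/
def IsRedundancy (n : ℕ) (k : Fin (n + 1) → Toeplitz ℰ) : Prop :=
  (∀ i : Fin (n + 1), k i ∈ khat ℰ (i : ℕ)) ∧ ∀ x ∈ khat ℰ n, ∑ i, k i * x = 0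

/-- The closed two-sided ideal generated by the sums of all redundancies. -/
noncomputable def redundancyIdeal : Ideal (Toeplitz ℰ) :=
  closedIdealSpan {s | ∃ n, ∃ k : Fin (n + 1) → Toeplitz ℰ, IsRedundancy ℰ n k ∧ s = ∑ i, k i}

noncomputable instance : (redundancyIdeal ℰ).IsTwoSided :=
  inferInstanceAs (closedIdealSpan (A := Toeplitz ℰ) _).IsTwoSided

instance : IsClosed (redundancyIdeal ℰ : Set (Toeplitz ℰ)) :=
  inferInstanceAs (IsClosed ((closedIdealSpan (A := Toeplitz ℰ) _ : Ideal (Toeplitz ℰ)) :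
    Set (Toeplitz ℰ)))

end Toeplitz

/-- The C*-algebra of the pair: the quotient of the Toeplitz algebra by the redundancy ideal. -/
abbrev PairAlgebra : Type (u + 1) := Toeplitz ℰ ⧸ Toeplitz.redundancyIdeal ℰ

/-- The quotient map. -/
noncomputable def q : Toeplitz ℰ →⋆ₐ[ℂ] PairAlgebra ℰ := CStarQuotient.mk (Toeplitz.redundancyIdeal ℰ)

/-- The image of `ê n` in the quotient. -/
noncomputable def e (n : ℕ) : PairAlgebra ℰ := q ℰ (Toeplitz.ehat ℰ n)

/-! ### The inductive limit of the adjointable operators -/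

/-- The inductive limit of the algebras of adjointable operators on the Hilbert modules of the
`E n`. The sequence starts at `n = 0`, which does not change the limit. -/
abbrev Limit : Type u := InductiveLimit fun n => CondExp.connOp (ℰ.comp n)

namespace Limit

/-- The canonical map of the adjointable operators on the `n`-th Hilbert module into the limit. -/
noncomputable def of (n : ℕ) : CondExp.Adjointable (ℰ.E n) →⋆ₐ[ℂ] Limit ℰ :=
  InductiveLimit.of (fun n => CondExp.connOp (ℰ.comp n)) n

/-- The canonical copy of `A` in the limit, through the left action on the Hilbert modules. -/
noncomputable def incl : A →⋆ₐ[ℂ] Limit ℰ := (of ℰ 0).comp (CondExp.leftMul (ℰ.E 0))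

/-- The left actions on all the Hilbert modules give the same copy of `A` in the limit. -/
theorem incl_eq (n : ℕ) (a : A) : incl ℰ a = of ℰ n (CondExp.leftMul (ℰ.E n) a) := by
  induction n with
  | zero => rfl
  | succ n ih =>
    rw [ih, of, of, ← InductiveLimit.of_succ]
    congr 1
    refine CondExp.Adjointable.ext (CondExp.clm_ext _ fun x => ?_)
    rw [← CondExp.conn_incl (ℰ.comp n), CondExp.connOp_conn, CondExp.leftMul_incl,
      CondExp.conn_incl (ℰ.comp n), CondExp.conn_incl (ℰ.comp n), CondExp.leftMul_incl]

/-- The image in the limit of the projection `incl x ↦ incl (E n x)` on the `n`-th Hilbert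
module. -/
noncomputable def echeck (n : ℕ) : Limit ℰ := of ℰ n (CondExp.proj (ℰ.E n))

/-- The C*-algebra generated by `A` and the projections in the limit. -/
noncomputable def generated : StarSubalgebra ℂ (Limit ℰ) :=
  (StarAlgebra.adjoin ℂ (Set.range (incl ℰ) ∪ Set.range (echeck ℰ))).topologicalClosure

end Limit

end CondExpSeq

end ApproximatelyProper

/-! Write `K n` for `khat n` and `F n` for `K 0 + ⋯ + K n`. The relations of the Toeplitz algebra
hold for the copy of `A` and the projections in the limit, so the universal property gives a
homomorphism `toLimit`. It is determined by its values on the generators. What has to be shown is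
that its kernel is exactly the redundancy ideal.

The relations give `K n * K m ⊆ K m` for `n ≤ m` (`khat_mul_khat`). Hence each `F n` is a
*-subalgebra in which `K n` is a closed ideal. It is also closed, because the sum of a C*-subalgebra
and a closed ideal is closed. The union of the `F n` is dense (`dense_filtration`). Faithfulness of
the expectations makes the connecting maps injective, so the adjointable operators on the `n`-th
module embed in the limit, and `toLimit` sends `F n` into that copy (`toLimit_mem_range`).

Redundancies are killed: the sum of an `n`-redundancy becomes an operator `T` on the `n`-th module
that annihilates every `a ě n`. Applied to the class of `1`, this says that `T` vanishes on the
dense image of `A` (`toLimit_sum_eq_zero`).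

Conversely, `toLimit` is injective on each `K n` (`eq_zero_of_mem_khat`). The corners `ê n a k b ê
n` of `k ∈ K n` are limits of elements `r ê n` with `r ∈ R n`, and there the map is bounded below,
since `r ě n` sends the class of `1` to that of `r`, of norm `‖r‖`. If `x ∈ F n` is in the kernel,
then `x y ∈ K n` is in the kernel for all `y ∈ K n`, so `x y = 0`, and `x` is the sum of a
redundancy (`mem_redundancyIdeal`).

So the kernel on each `F n` lies in the redundancy ideal. To reach the whole algebra this is turned
into the estimate `‖q x‖ ≤ ‖toLimit x‖` (`norm_q_le`), which extends from the dense union by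
continuity and makes the map on the quotient injective. Its range is closed, hence equal to the
C*-algebra generated by `A` and the projections. -/

section LimitRealization

open scoped CStarAlgebra

/-! ### Factoring through quotients, closed ranges, and sums of C*-subalgebras and ideals. -/

section CStarHom

variable {B : Type u} {C : Type v} [CStarAlgebra B] [CStarAlgebra C]

/-- A *-homomorphism that vanishes on a closed two-sided ideal factors through the quotient. -/
noncomputable def CStarQuotient.lift (J : Ideal B) [J.IsTwoSided] [IsClosed (J : Set B)]
    (f : B →⋆ₐ[ℂ] C) (h : ∀ x ∈ J, f x = 0) : B ⧸ J →⋆ₐ[ℂ] C where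
  __ := Ideal.Quotient.liftₐ J f.toAlgHom h
  map_star' x := by
    obtain ⟨x, rfl⟩ := Ideal.Quotient.mk_surjective x
    exact map_star f x

theorem CStarQuotient.norm_mk_le (J : Ideal B) [J.IsTwoSided] [IsClosed (J : Set B)] (x : B) :
    ‖CStarQuotient.mk J x‖ ≤ ‖x‖ := Submodule.Quotient.norm_mk_le J x

theorem StarAlgHom.isClosed_ker (f : B →⋆ₐ[ℂ] C) : IsClosed (RingHom.ker f : Set B) :=
  isClosed_eq (map_continuous f) continuous_const

instance (f : B →⋆ₐ[ℂ] C) : IsClosed (RingHom.ker f : Set B) := StarAlgHom.isClosed_ker f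

/-- The injective *-homomorphism on the quotient by the kernel. -/
noncomputable def StarAlgHom.kerLift (f : B →⋆ₐ[ℂ] C) : B ⧸ RingHom.ker f →⋆ₐ[ℂ] C :=
  CStarQuotient.lift (RingHom.ker f) f fun _ hx => hx

theorem StarAlgHom.kerLift_injective (f : B →⋆ₐ[ℂ] C) : Function.Injective f.kerLift := by
  rw [injective_iff_map_eq_zero]
  intro z hz
  obtain ⟨z, rfl⟩ := Ideal.Quotient.mk_surjective z
  exact Ideal.Quotient.eq_zero_iff_mem.2 hz

/-- Every element of the range of a *-homomorphism has preimages of almost the same norm. -/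
theorem StarAlgHom.exists_norm_lt (f : B →⋆ₐ[ℂ] C) (x : B) {ε : ℝ} (hε : 0 < ε) :
    ∃ y, f y = f x ∧ ‖y‖ < ‖f x‖ + ε := by
  -- The injective map `f.kerLift` is isometric, so the quotient norm of the class of `x` is `‖f
  -- x‖`. The element `y` is a representative that nearly attains it.
  obtain ⟨y, hy, hlt⟩ := Submodule.Quotient.norm_mk_lt (CStarQuotient.mk (RingHom.ker f) x) hε
  refine ⟨y, congrArg f.kerLift hy, hlt.trans_eq ?_⟩
  congr 1
  exact (NonUnitalStarAlgHom.norm_map f.kerLift f.kerLift_injective _).symm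

/-- The range of a *-homomorphism between C*-algebras is closed. -/
theorem StarAlgHom.isClosed_range (f : B →⋆ₐ[ℂ] C) : IsClosed (Set.range f) := by
  have hr : Set.range f = Set.range f.kerLift := by
    rw [← Ideal.Quotient.mk_surjective.range_comp f.kerLift]
    rfl
  rw [hr]
  exact (NonUnitalStarAlgHom.isometry f.kerLift
    f.kerLift_injective).isClosedEmbedding.isClosed_range

/-- The sum of a *-subalgebra `S` and a self-adjoint subspace `K` that is an ideal of `S + K`. -/
def StarSubalgebra.addSubmodule (S : StarSubalgebra ℂ B) (K : Submodule ℂ B)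
    (hstar : ∀ k ∈ K, star k ∈ K) (hSK : ∀ s ∈ S, ∀ k ∈ K, s * k ∈ K)
    (hKK : ∀ k ∈ K, ∀ l ∈ K, k * l ∈ K) : StarSubalgebra ℂ B where
  carrier := {x | ∃ s ∈ S, ∃ k ∈ K, s + k = x}
  add_mem' := by
    rintro _ _ ⟨s, hs, k, hk, rfl⟩ ⟨t, ht, l, hl, rfl⟩
    exact ⟨s + t, add_mem hs ht, k + l, add_mem hk hl, by abel⟩
  mul_mem' := by
    rintro _ _ ⟨s, hs, k, hk, rfl⟩ ⟨t, ht, l, hl, rfl⟩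
    refine ⟨s * t, mul_mem hs ht, s * l + k * t + k * l, ?_, by noncomm_ring⟩
    refine add_mem (add_mem (hSK s hs l hl) ?_) (hKK k hk l hl)
    -- Right absorption follows from left absorption by adjoints: `k * t = star (star t * star k)`.
    have := hstar _ (hSK _ (star_mem ht) _ (hstar k hk))
    rwa [star_mul, star_star, star_star] at this
  algebraMap_mem' c := ⟨algebraMap ℂ B c, S.algebraMap_mem c, 0, K.zero_mem, add_zero _⟩
  star_mem' := by
    rintro _ ⟨s, hs, k, hk, rfl⟩
    exact ⟨star s, star_mem hs, star k, hstar k hk, (star_add s k).symm⟩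

/-- The sum of a C*-subalgebra and a closed ideal is closed. -/
theorem StarSubalgebra.isClosed_addSubmodule (S : StarSubalgebra ℂ B)
    (hS : IsClosed (S : Set B)) (K : Submodule ℂ B) (hK : IsClosed (K : Set B))
    (hstar : ∀ k ∈ K, star k ∈ K) (hSK : ∀ s ∈ S, ∀ k ∈ K, s * k ∈ K)
    (hKK : ∀ k ∈ K, ∀ l ∈ K, k * l ∈ K) :
    IsClosed (S.addSubmodule K hstar hSK hKK : Set B) := by
  -- In the closure `W` of `D = S + K` the space `K` is a closed ideal `J`. The image of `S` in `W ⧸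
  -- J` is the range of a *-homomorphism, hence closed, and so is its preimage in `W`. That preimage
  -- is `D` itself, and `D` is dense in `W`.
  set D := S.addSubmodule K hstar hSK hKK with hD
  set W := D.topologicalClosure with hW
  have hWc : IsClosed (W : Set B) := StarSubalgebra.isClosed_topologicalClosure _
  have hWK : ∀ w ∈ W, ∀ k ∈ K, w * k ∈ K := by
    intro w hw k hk
    have : (D : Set B) ⊆ {w | w * k ∈ K} := by
      rintro _ ⟨s, hs, l, hl, rfl⟩
      change (s + l) * k ∈ K
      rw [add_mul]
      exact add_mem (hSK s hs k hk) (hKK l hl k hk)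
    exact closure_minimal this (hK.preimage (continuous_mul_const k)) hw
  have hKW : ∀ w ∈ W, ∀ k ∈ K, k * w ∈ K := fun w hw k hk => by
    have := hstar _ (hWK _ (star_mem hw) _ (hstar k hk))
    rwa [star_mul, star_star, star_star] at this
  have hDW : ∀ {x}, x ∈ D → x ∈ W := fun hx => StarSubalgebra.le_topologicalClosure _ hx
  let J : Ideal W :=
    { carrier := {w | w.1 ∈ K}
      add_mem' := fun hx hy => K.add_mem hx hy
      zero_mem' := K.zero_mem
      smul_mem' := fun w k hk => hWK w.1 w.2 k.1 hk }
  have : J.IsTwoSided := ⟨fun {k} w hk => hKW w.1 w.2 k.1 hk⟩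
  have : IsClosed (J : Set W) := hK.preimage continuous_subtype_val
  have hSD : S ≤ W := fun s hs => hDW ⟨s, hs, 0, K.zero_mem, add_zero s⟩
  let f : S →⋆ₐ[ℂ] W ⧸ J := (CStarQuotient.mk J).comp (StarSubalgebra.inclusion hSD)
  have hf : IsClosed (Set.range f) := StarAlgHom.isClosed_range f
  have hcl : IsClosed (CStarQuotient.mk J ⁻¹' Set.range f) :=
    hf.preimage (map_continuous (CStarQuotient.mk J))
  have hdense : ∀ w : W, w ∈ closure {w : W | w.1 ∈ D} := by
    intro w
    rw [closure_subtype]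
    have h : ((↑) '' {w : W | w.1 ∈ D} : Set B) = D := by
      ext x
      exact ⟨fun ⟨w, hw, hx⟩ => hx ▸ hw, fun hx => ⟨⟨x, hDW hx⟩, hx, rfl⟩⟩
    rw [h]
    exact w.2
  refine isClosed_of_closure_subset fun x hx => ?_
  have hmem : (⟨x, hx⟩ : W) ∈ CStarQuotient.mk J ⁻¹' Set.range f := by
    refine closure_minimal ?_ hcl (hdense ⟨x, hx⟩)
    rintro ⟨_, hw⟩ ⟨s, hs, k, hk, rfl⟩
    refine ⟨⟨s, hs⟩, ?_⟩
    refine (Ideal.Quotient.mk_eq_mk_iff_sub_mem _ _).2 ?_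
    change s - (s + k) ∈ K
    rw [sub_add_cancel_left]
    exact K.neg_mem hk
  obtain ⟨s, hs⟩ := hmem
  have h1 : x - s.1 ∈ K := (Ideal.Quotient.mk_eq_mk_iff_sub_mem _ _).1 hs.symm
  exact ⟨s.1, s.2, x - s.1, h1, add_sub_cancel _ _⟩

end CStarHom

/-! ### Faithfulness and the injectivity of the canonical maps. -/

section LimitInjective

/-- Injective *-homomorphisms are isometric, so the norms along the sequence of `b` are constantly
`‖b‖` from the place `n` on; such a sequence is null only if `b = 0`. -/
theorem InductiveLimit.of_injective {B : ℕ → Type u} [∀ n, CStarAlgebra (B n)]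
    (Φ : ∀ n, B n →⋆ₐ[ℂ] B (n + 1)) (hΦ : ∀ n, Function.Injective (Φ n)) (n : ℕ) :
    Function.Injective (InductiveLimit.of Φ n) := by
  rw [injective_iff_map_eq_zero]
  intro b hb
  have h : bseq Φ n b ∈ nullIdeal B := Ideal.Quotient.eq_zero_iff_mem.1 (congrArg Subtype.val hb)
  have h1 : ∀ m ≥ n, ‖seq Φ n b m‖ = ‖b‖ := by
    refine seq_ind n (by rw [seq_self]) fun m hm ih => ?_
    rw [seq_succ Φ hm, NonUnitalStarAlgHom.norm_map (Φ m) (hΦ m), ih]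
  have h2 : Tendsto (fun m => ‖seq Φ n b m‖) atTop (𝓝 ‖b‖) :=
    tendsto_const_nhds.congr' (by
      filter_upwards [eventually_ge_atTop n] with m hm
      exact (h1 m hm).symm)
  exact norm_eq_zero.1 (tendsto_nhds_unique h2 h)

variable {A : Type u} [CStarAlgebra A] [PartialOrder A] [StarOrderedRing A]
  {R R' : StarSubalgebra ℂ A} {E : CondExp R} {E' : CondExp R'}

/-- The inner product of `conn ξ` with itself is `E' ⟨ξ, ξ⟩`, and a faithful `E'` vanishes on the
positive element `⟨ξ, ξ⟩` only if that element is zero. -/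
theorem CondExp.conn_eq_zero (hE' : E'.Faithful) (h : ∀ a, E' (E a) = E' a)
    {ξ : CondExp.HilbertModule E} (hξ : CondExp.conn E E' ξ = 0) : ξ = 0 := by
  have h1 := CondExp.inner_conn h ξ ξ
  rw [hξ, map_zero] at h1
  have h2 := hE' _ (CondExp.HilbertModule.inner_self_nonneg ξ) h1.symm
  have h3 := CondExp.HilbertModule.norm_inner_self ξ
  rw [h2, norm_zero] at h3
  exact norm_eq_zero.1 (pow_eq_zero_iff two_ne_zero |>.1 h3.symm)

theorem CondExp.connOp_injective (hE' : E'.Faithful) (h : ∀ a, E' (E a) = E' a) :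
    Function.Injective (CondExp.connOp h) := by
  rw [injective_iff_map_eq_zero]
  intro T hT
  refine CondExp.Adjointable.ext (ContinuousLinearMap.ext fun ξ => ?_)
  refine CondExp.conn_eq_zero hE' h ?_
  rw [← CondExp.connOp_conn h, hT]
  rfl

/-- Tested on the class of `1`: the class of `a` has squared norm `‖E (star a * a)‖`, which is
nonzero for `a ≠ 0` by faithfulness. -/
theorem CondExp.leftMul_injective (hE : E.Faithful) : Function.Injective (CondExp.leftMul E) := by
  rw [injective_iff_map_eq_zero]
  intro a ha
  have h1 := CondExp.leftMul_incl E a 1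
  rw [ha, mul_one] at h1
  have h2 := CondExp.HilbertModule.norm_incl_sq E a
  rw [← h1] at h2
  have h3 : ‖E (star a * a)‖ = 0 := by
    rw [← h2]
    change ‖(0 : CondExp.HilbertModule E)‖ ^ 2 = 0
    simp
  have h4 := hE _ (star_mul_self_nonneg a) (norm_eq_zero.1 h3)
  exact (CStarRing.star_mul_self_eq_zero_iff a).1 h4

end LimitInjective

namespace CondExpSeq

set_option linter.unusedSectionVars false

variable {A : Type u} [CStarAlgebra A] [PartialOrder A] [StarOrderedRing A]
  {ℛ : ApproxProper A} (ℰ : CondExpSeq ℛ)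

/-! ### The representation in the limit -/

namespace Limit

theorem of_injective (n : ℕ) : Function.Injective (of ℰ n) :=
  InductiveLimit.of_injective _
    (fun n => CondExp.connOp_injective (ℰ.faithful (n + 1)) (ℰ.comp n)) n

theorem incl_injective : Function.Injective (incl ℰ) :=
  (of_injective ℰ 0).comp (CondExp.leftMul_injective (ℰ.faithful 0))

theorem star_proj {R : StarSubalgebra ℂ A} (E : CondExp R) :
    star (CondExp.proj E) = CondExp.proj E :=
  CondExp.Adjointable.star_eq (CondExp.inner_projCLM E)

theorem proj_mul_proj {R : StarSubalgebra ℂ A} (E : CondExp R) :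
    CondExp.proj E * CondExp.proj E = CondExp.proj E := by
  refine CondExp.Adjointable.ext (CondExp.clm_ext E fun x => ?_)
  change (CondExp.proj E).toCLM ((CondExp.proj E).toCLM _) = _
  rw [CondExp.proj_incl, CondExp.proj_incl, E.map_of_mem (E.map_mem x)]

theorem proj_mul_leftMul_mul_proj {R : StarSubalgebra ℂ A} (E : CondExp R) (a : A) :
    CondExp.proj E * CondExp.leftMul E a * CondExp.proj E
      = CondExp.leftMul E (E a) * CondExp.proj E := by
  refine CondExp.Adjointable.ext (CondExp.clm_ext E fun x => ?_)
  change (CondExp.proj E).toCLM ((CondExp.leftMul E a).toCLM ((CondExp.proj E).toCLM _))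
    = (CondExp.leftMul E (E a)).toCLM ((CondExp.proj E).toCLM _)
  rw [CondExp.proj_incl, CondExp.leftMul_incl, CondExp.leftMul_incl, CondExp.proj_incl,
    E.map_mul_right _ (E.map_mem x)]

/-- On the class of `x` this is the identity `E' (E x) = E' x`. The projections live on different
modules, so one has to be transported before they can be multiplied; the result is the relation
`e_succ_mul` in the limit. -/
theorem proj_mul_connOp_proj {R R' : StarSubalgebra ℂ A} {E : CondExp R} {E' : CondExp R'}
    (h : ∀ a, E' (E a) = E' a) :
    CondExp.proj E' * CondExp.connOp h (CondExp.proj E) = CondExp.proj E' := by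
  refine CondExp.Adjointable.ext (CondExp.clm_ext E' fun x => ?_)
  change (CondExp.proj E').toCLM ((CondExp.connOp h (CondExp.proj E)).toCLM _) = _
  rw [← CondExp.conn_incl h, CondExp.connOp_conn, CondExp.proj_incl, CondExp.conn_incl h,
    CondExp.conn_incl h, CondExp.proj_incl, CondExp.proj_incl, h]

/-- The generators in the limit satisfy the relations of the Toeplitz algebra. -/
noncomputable def rep : ToeplitzRep ℰ (Limit ℰ) where
  φ := incl ℰ
  e := echeck ℰ
  isStarProjection n := by
    refine ⟨?_, ?_⟩
    · change of ℰ n _ * of ℰ n _ = of ℰ n _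
      rw [← map_mul, proj_mul_proj]
    · change star (of ℰ n _) = of ℰ n _
      rw [← map_star, star_proj]
  e_zero := by
    -- Since `R 0` is all of `A`, the expectation `E 0` is the identity.
    have h : CondExp.proj (ℰ.E 0) = 1 := by
      refine CondExp.Adjointable.ext (CondExp.clm_ext _ fun x => ?_)
      rw [CondExp.proj_incl, (ℰ.E 0).map_of_mem (by rw [ℛ.zero_eq]; trivial)]
      rfl
    rw [echeck, h, map_one]
  e_succ_mul n := by
    have h : echeck ℰ n = of ℰ (n + 1) (CondExp.connOp (ℰ.comp n) (CondExp.proj (ℰ.E n))) :=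
      (InductiveLimit.of_succ (fun n => CondExp.connOp (ℰ.comp n)) n _).symm
    rw [h, echeck, ← map_mul, proj_mul_connOp_proj]
  e_mul_mul n a := by
    rw [incl_eq ℰ n, incl_eq ℰ n, echeck, ← map_mul, ← map_mul, ← map_mul,
      proj_mul_leftMul_mul_proj]

/-- On the corner of `echeck n` the algebra `R n` is represented isometrically. -/
theorem norm_incl_mul_echeck {n : ℕ} {r : A} (hr : r ∈ ℛ.R n) :
    ‖r‖ ≤ ‖incl ℰ r * echeck ℰ n‖ := by
  rw [incl_eq ℰ n, echeck, ← map_mul, NonUnitalStarAlgHom.norm_map _ (of_injective ℰ n)]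
  set E := ℰ.E n
  set T := CondExp.leftMul E r * CondExp.proj E with hT
  -- The class of `1` is the test vector: `T` sends it to the class of `r`, whose norm is `‖r‖`
  -- because `E` fixes `star r * r`.
  have h1 : T.toCLM (CondExp.HilbertModule.incl E 1) = CondExp.HilbertModule.incl E r := by
    change (CondExp.leftMul E r).toCLM ((CondExp.proj E).toCLM _) = _
    rw [CondExp.proj_incl, E.map_one, CondExp.leftMul_incl, mul_one]
  have h2 : ‖CondExp.HilbertModule.incl E r‖ = ‖r‖ := by
    rw [CondExp.HilbertModule.norm_incl, E.map_of_mem (mul_mem (star_mem hr) hr),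
      CStarRing.norm_star_mul_self, Real.sqrt_mul_self (norm_nonneg _)]
  -- Only an inequality, since `A` may be the zero algebra.
  have h3 : ‖CondExp.HilbertModule.incl E 1‖ ≤ 1 := by
    rw [CondExp.HilbertModule.norm_incl, star_one, one_mul, E.map_one]
    exact Real.sqrt_le_one.2 (BoundedProd.norm_one_le A)
  rw [← h2, ← h1]
  exact (T.toCLM.le_opNorm _).trans (mul_le_of_le_one_right (norm_nonneg _) h3)

end Limit

/-! ### The Toeplitz algebra -/

namespace Toeplitz

/-- A closed *-subalgebra that contains the generators is the whole Toeplitz algebra. -/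
theorem eq_top_of_generators (S : StarSubalgebra ℂ (Toeplitz ℰ))
    (hS : IsClosed (S : Set (Toeplitz ℰ)))
    (hi : ∀ a, incl ℰ a ∈ S) (he : ∀ n, ehat ℰ n ∈ S) : S = ⊤ := by
  -- The Toeplitz algebra is the closure of an adjoin inside the bounded product, so `S` is moved
  -- there. It stays closed because the Toeplitz algebra is closed in the product.
  let S' : StarSubalgebra ℂ (BoundedProd (fun i : RepIndex ℰ => i.B)) :=
    S.map (toeplitzSubalgebra ℰ).subtype
  have hT : IsClosed (toeplitzSubalgebra ℰ : Set (BoundedProd (fun i : RepIndex ℰ => i.B))) :=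
    inferInstance
  have hc : IsClosed (S' : Set (BoundedProd (fun i : RepIndex ℰ => i.B))) :=
    hT.isClosedEmbedding_subtypeVal.isClosedMap _ hS
  have hle : toeplitzSubalgebra ℰ ≤ S' := by
    refine StarSubalgebra.topologicalClosure_minimal (StarAlgebra.adjoin_le ?_) hc
    rintro _ (⟨a, rfl⟩ | ⟨n, rfl⟩)
    · exact ⟨_, hi a, rfl⟩
    · exact ⟨_, he n, rfl⟩
  refine top_le_iff.1 fun x _ => ?_
  obtain ⟨y, hy, hxy⟩ := hle x.2
  rwa [← Subtype.ext hxy]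

theorem star_ehat (n : ℕ) : star (ehat ℰ n) = ehat ℰ n :=
  ((univRep ℰ).isStarProjection n).isSelfAdjoint

theorem ehat_mul_self (n : ℕ) : ehat ℰ n * ehat ℰ n = ehat ℰ n :=
  ((univRep ℰ).isStarProjection n).isIdempotentElem

theorem ehat_mul_incl_mul_ehat (n : ℕ) (a : A) :
    ehat ℰ n * incl ℰ a * ehat ℰ n = incl ℰ (ℰ.E n a) * ehat ℰ n :=
  (univRep ℰ).e_mul_mul n a

theorem ehat_mul_ehat {n m : ℕ} (h : n ≤ m) : ehat ℰ m * ehat ℰ n = ehat ℰ m := by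
  induction m, h using Nat.le_induction with
  | base => exact ehat_mul_self ℰ n
  | succ m _ ih =>
    have := (univRep ℰ).e_succ_mul m
    change ehat ℰ (m + 1) * ehat ℰ m = ehat ℰ (m + 1) at this
    rw [← this, mul_assoc, ih]

theorem ehat_mul_ehat' {n m : ℕ} (h : n ≤ m) : ehat ℰ n * ehat ℰ m = ehat ℰ m := by
  have := congrArg star (ehat_mul_ehat ℰ h)
  rwa [star_mul, star_ehat, star_ehat] at this

/-! ### The spaces `khat n` -/

theorem isClosed_khat (n : ℕ) : IsClosed (khat ℰ n : Set (Toeplitz ℰ)) :=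
  Submodule.isClosed_topologicalClosure _

theorem mul_mem_khat (n : ℕ) (a b : A) : incl ℰ a * ehat ℰ n * incl ℰ b ∈ khat ℰ n :=
  Submodule.le_topologicalClosure _ (Submodule.subset_span ⟨a, b, rfl⟩)

/-- A closed subspace that contains the elements `a ê n b` contains `khat n`. -/
theorem khat_le {n : ℕ} {V : Submodule ℂ (Toeplitz ℰ)} (hV : IsClosed (V : Set (Toeplitz ℰ)))
    (h : ∀ a b, incl ℰ a * ehat ℰ n * incl ℰ b ∈ V) : khat ℰ n ≤ V := by
  refine Submodule.topologicalClosure_minimal _ (Submodule.span_le.2 ?_) hV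
  rintro _ ⟨a, b, rfl⟩
  exact h a b

/-- Multiplication by `y` is linear and continuous, so a closed subspace only has to be tested on
the elements `a ê n b`. Taking `V = ⊥` gives vanishing statements. -/
theorem mul_khat_subset {n : ℕ} {y : Toeplitz ℰ} {V : Submodule ℂ (Toeplitz ℰ)}
    (hV : IsClosed (V : Set (Toeplitz ℰ)))
    (h : ∀ a b, y * (incl ℰ a * ehat ℰ n * incl ℰ b) ∈ V) {x : Toeplitz ℰ} (hx : x ∈ khat ℰ n) :
    y * x ∈ V :=
  khat_le ℰ (V := V.comap (LinearMap.mulLeft ℂ y)) (hV.preimage (continuous_const_mul y)) h hx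

theorem khat_mul_subset {n : ℕ} {y : Toeplitz ℰ} {V : Submodule ℂ (Toeplitz ℰ)}
    (hV : IsClosed (V : Set (Toeplitz ℰ)))
    (h : ∀ a b, incl ℰ a * ehat ℰ n * incl ℰ b * y ∈ V) {x : Toeplitz ℰ} (hx : x ∈ khat ℰ n) :
    x * y ∈ V :=
  khat_le ℰ (V := V.comap (LinearMap.mulRight ℂ y)) (hV.preimage (continuous_mul_const y)) h hx

/-- For `n ≤ m` one may write `ê m = ê n ê m`, and then `ê n b c ê n` compresses to `E n (b c) ê n`.
Thus `(a ê n b)(c ê m d) = a E n (b c) ê m d`. -/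
theorem khat_mul_khat {n m : ℕ} (h : n ≤ m) {x y : Toeplitz ℰ} (hx : x ∈ khat ℰ n)
    (hy : y ∈ khat ℰ m) : x * y ∈ khat ℰ m := by
  refine khat_mul_subset ℰ (isClosed_khat ℰ m) (fun a b => ?_) hx
  refine mul_khat_subset ℰ (isClosed_khat ℰ m) (fun c d => ?_) hy
  have key : incl ℰ a * ehat ℰ n * incl ℰ b * (incl ℰ c * ehat ℰ m * incl ℰ d)
      = incl ℰ (a * ℰ.E n (b * c)) * ehat ℰ m * incl ℰ d := by
    calc _ = incl ℰ a * (ehat ℰ n * incl ℰ (b * c) * ehat ℰ n) * ehat ℰ m * incl ℰ d := by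
          rw [map_mul]
          nth_rewrite 1 [← ehat_mul_ehat' ℰ h]
          simp only [mul_assoc]
      _ = _ := by
          rw [ehat_mul_incl_mul_ehat, map_mul (incl ℰ) a]
          simp only [mul_assoc]
          rw [← mul_assoc (ehat ℰ n) (ehat ℰ m), ehat_mul_ehat' ℰ h]
  rw [key]
  exact mul_mem_khat ℰ m _ _

theorem star_mem_khat {n : ℕ} {x : Toeplitz ℰ} (hx : x ∈ khat ℰ n) : star x ∈ khat ℰ n := by
  let V : Submodule ℂ (Toeplitz ℰ) :=
    { carrier := {x | star x ∈ khat ℰ n}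
      add_mem' := fun {x y} hx hy => by
        rw [Set.mem_ofPred_eq, star_add]
        exact add_mem hx hy
      zero_mem' := by
        rw [Set.mem_ofPred_eq, star_zero]
        exact zero_mem _
      smul_mem' := fun c x hx => by
        rw [Set.mem_ofPred_eq, star_smul]
        exact Submodule.smul_mem _ _ hx }
  refine khat_le ℰ (V := V) ((isClosed_khat ℰ n).preimage continuous_star) (fun a b => ?_) hx
  change star _ ∈ khat ℰ n
  rw [star_mul, star_mul, star_ehat, ← map_star, ← map_star, ← mul_assoc]
  exact mul_mem_khat ℰ n _ _

theorem incl_mem_khat_zero (a : A) : incl ℰ a ∈ khat ℰ 0 := by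
  have h := mul_mem_khat ℰ 0 a 1
  have h0 : ehat ℰ 0 = 1 := (univRep ℰ).e_zero
  rwa [h0, mul_one, map_one, mul_one] at h

theorem ehat_mem_khat (n : ℕ) : ehat ℰ n ∈ khat ℰ n := by
  have h := mul_mem_khat ℰ n 1 1
  rwa [map_one, mul_one, one_mul] at h

/-! ### The filtration -/

/-- The spaces `khat 0 + ⋯ + khat n`. -/
noncomputable def filtration : ℕ → Submodule ℂ (Toeplitz ℰ)
  | 0 => khat ℰ 0
  | n + 1 => filtration n ⊔ khat ℰ (n + 1)

theorem filtration_mono : Monotone (filtration ℰ) :=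
  monotone_nat_of_le_succ fun _ => le_sup_left

theorem khat_le_filtration (n : ℕ) : khat ℰ n ≤ filtration ℰ n := by
  cases n with
  | zero => exact le_rfl
  | succ n => exact le_sup_right

/-- This is what makes `khat (n + 1)` an ideal of the next space of the filtration, and what brings
a product `x * y` into `khat n`, where the map into the limit is injective. -/
theorem filtration_mul_khat {n m : ℕ} (h : n ≤ m) {x y : Toeplitz ℰ} (hx : x ∈ filtration ℰ n)
    (hy : y ∈ khat ℰ m) : x * y ∈ khat ℰ m := by
  induction n generalizing x with
  | zero => exact khat_mul_khat ℰ h hx hy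
  | succ n ih =>
    obtain ⟨s, hs, k, hk, rfl⟩ := Submodule.mem_sup.1 hx
    rw [add_mul]
    exact add_mem (ih (n.le_succ.trans h) hs) (khat_mul_khat ℰ h hk hy)

/-- Brings an element of the filtration into the form of a tuple that `IsRedundancy` requires. -/
theorem exists_sum_of_mem_filtration {n : ℕ} {x : Toeplitz ℰ} (hx : x ∈ filtration ℰ n) :
    ∃ k : Fin (n + 1) → Toeplitz ℰ, (∀ i : Fin (n + 1), k i ∈ khat ℰ (i : ℕ)) ∧ x = ∑ i, k i := by
  induction n generalizing x with
  | zero => exact ⟨fun _ => x, fun i => by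
      rw [Fin.val_eq_zero i]
      exact hx, by simp⟩
  | succ n ih =>
    obtain ⟨s, hs, k, hk, rfl⟩ := Submodule.mem_sup.1 hx
    obtain ⟨l, hl, rfl⟩ := ih hs
    refine ⟨Fin.snoc (α := fun _ => Toeplitz ℰ) l k, fun i => ?_, by simp [Fin.sum_univ_castSucc]⟩
    refine Fin.lastCases ?_ (fun j => ?_) i
    · simpa using hk
    · simpa using hl j

/-- The spaces of the filtration are C*-subalgebras. -/
theorem exists_starSubalgebra_filtration (n : ℕ) :
    ∃ S : StarSubalgebra ℂ (Toeplitz ℰ), (∀ x, x ∈ S ↔ x ∈ filtration ℰ n) ∧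
      IsClosed (S : Set (Toeplitz ℰ)) := by
  induction n with
  | zero =>
    exact ⟨{  carrier := khat ℰ 0
              mul_mem' := khat_mul_khat ℰ le_rfl
              add_mem' := add_mem
              algebraMap_mem' := fun c => by
                rw [← AlgHomClass.commutes (incl ℰ)]
                exact incl_mem_khat_zero ℰ _
              star_mem' := star_mem_khat ℰ }, fun _ => Iff.rfl, isClosed_khat ℰ 0⟩
  | succ n ih =>
    -- Closedness is carried through the induction because the closedness of `S + khat (n + 1)`
    -- depends on that of `S`.
    obtain ⟨S, hS, hc⟩ := ih
    have h1 : ∀ k ∈ khat ℰ (n + 1), star k ∈ khat ℰ (n + 1) := fun k => star_mem_khat ℰ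
    have h2 : ∀ s ∈ S, ∀ k ∈ khat ℰ (n + 1), s * k ∈ khat ℰ (n + 1) := fun s hs k hk =>
      filtration_mul_khat ℰ n.le_succ ((hS s).1 hs) hk
    have h3 : ∀ k ∈ khat ℰ (n + 1), ∀ l ∈ khat ℰ (n + 1), k * l ∈ khat ℰ (n + 1) :=
      fun k hk l hl => khat_mul_khat ℰ le_rfl hk hl
    refine ⟨S.addSubmodule (khat ℰ (n + 1)) h1 h2 h3, fun x => ?_,
      S.isClosed_addSubmodule hc _ (isClosed_khat ℰ (n + 1)) h1 h2 h3⟩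
    refine Iff.trans ?_ Submodule.mem_sup.symm
    exact ⟨fun ⟨s, hs, t⟩ => ⟨s, (hS s).1 hs, t⟩, fun ⟨s, hs, t⟩ => ⟨s, (hS s).2 hs, t⟩⟩

/-- The union of an increasing chain of *-subalgebras is a *-subalgebra. It contains `A` at the
level `0` and `ê n` at the level `n`, so its closure is everything. -/
theorem dense_filtration : Dense {x : Toeplitz ℰ | ∃ n, x ∈ filtration ℰ n} := by
  choose S hS _ using exists_starSubalgebra_filtration ℰ
  let D : StarSubalgebra ℂ (Toeplitz ℰ) :=
    { carrier := {x : Toeplitz ℰ | ∃ n, x ∈ filtration ℰ n}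
      mul_mem' := by
        rintro x y ⟨n, hx⟩ ⟨m, hy⟩
        refine ⟨max n m, (hS _ _).1 (mul_mem ((hS _ _).2 ?_) ((hS _ _).2 ?_))⟩
        · exact filtration_mono ℰ (le_max_left n m) hx
        · exact filtration_mono ℰ (le_max_right n m) hy
      add_mem' := by
        rintro x y ⟨n, hx⟩ ⟨m, hy⟩
        exact ⟨max n m, add_mem (filtration_mono ℰ (le_max_left n m) hx)
          (filtration_mono ℰ (le_max_right n m) hy)⟩
      algebraMap_mem' := fun c => ⟨0, (hS _ _).1 ((S 0).algebraMap_mem c)⟩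
      star_mem' := by
        rintro x ⟨n, hx⟩
        exact ⟨n, (hS _ _).1 (star_mem ((hS _ _).2 hx))⟩ }
  have h := eq_top_of_generators ℰ D.topologicalClosure
    (StarSubalgebra.isClosed_topologicalClosure D)
    (fun a => StarSubalgebra.le_topologicalClosure D ⟨0, incl_mem_khat_zero ℰ a⟩)
    (fun n => StarSubalgebra.le_topologicalClosure D
      ⟨n, khat_le_filtration ℰ n (ehat_mem_khat ℰ n)⟩)
  intro x
  change x ∈ D.topologicalClosure
  rw [h]
  trivial

/-! ### The homomorphism into the limit and its uniqueness. -/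

/-- The canonical *-homomorphism of the Toeplitz algebra into the limit. -/
noncomputable def toLimit : Toeplitz ℰ →⋆ₐ[ℂ] Limit ℰ := lift ℰ (Limit.rep ℰ)

theorem toLimit_incl (a : A) : toLimit ℰ (incl ℰ a) = Limit.incl ℰ a := rfl

theorem toLimit_ehat (n : ℕ) : toLimit ℰ (ehat ℰ n) = Limit.echeck ℰ n := rfl

theorem incl_injective : Function.Injective (incl ℰ) := fun _ _ h =>
  Limit.incl_injective ℰ (congrArg (toLimit ℰ) h)

/-- *-Homomorphisms that agree with `toLimit` on the generators are equal to it. -/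
theorem eq_toLimit (ρ : ℰ.Toeplitz →⋆ₙₐ[ℂ] ℰ.Limit) (hi : ∀ a, ρ (incl ℰ a) = Limit.incl ℰ a)
    (he : ∀ n, ρ (ehat ℰ n) = Limit.echeck ℰ n) (x : Toeplitz ℰ) : ρ x = toLimit ℰ x := by
  let S : StarSubalgebra ℂ (Toeplitz ℰ) :=
    { carrier := {x | ρ x = toLimit ℰ x}
      mul_mem' := fun {x y} hx hy => by
        rw [Set.mem_ofPred_eq] at hx hy ⊢
        rw [map_mul, map_mul, hx, hy]
      add_mem' := fun {x y} hx hy => by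
        rw [Set.mem_ofPred_eq] at hx hy ⊢
        rw [map_add, map_add, hx, hy]
      -- The map `ρ` is not assumed to be unital, but scalars lie in the copy of `A`, on which its
      -- values are prescribed.
      algebraMap_mem' := fun c => by
        rw [Set.mem_ofPred_eq, ← AlgHomClass.commutes (incl ℰ), hi, toLimit_incl]
      star_mem' := fun {x} hx => by
        rw [Set.mem_ofPred_eq] at hx ⊢
        rw [map_star, map_star, hx] }
  have hS := eq_top_of_generators ℰ S
    (isClosed_eq (map_continuous ρ) (map_continuous (toLimit ℰ))) hi he
  have hx : x ∈ S := by
    rw [hS]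
    trivial
  exact hx

/-! ### Injectivity on the spaces `khat n` -/

/-- On the corners of the spaces `khat n` the map into the limit is bounded below. -/
theorem norm_corner_le {n : ℕ} (a b : A) {k : Toeplitz ℰ} (hk : k ∈ khat ℰ n) :
    ‖ehat ℰ n * incl ℰ a * k * (incl ℰ b * ehat ℰ n)‖
      ≤ ‖toLimit ℰ (ehat ℰ n * incl ℰ a * k * (incl ℰ b * ehat ℰ n))‖ := by
  -- `V` is `R n ê n`. There `‖r ê n‖ ≤ ‖r‖ ≤ ‖r ě n‖`, and the estimate passes to the closure,
  -- which contains all corners of `khat n`.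
  let V : Submodule ℂ (Toeplitz ℰ) := (ℛ.R n).toSubalgebra.toSubmodule.map
    (LinearMap.mulRight ℂ (ehat ℰ n) ∘ₗ (incl ℰ).toAlgHom.toLinearMap)
  have hV : ∀ x ∈ V.topologicalClosure, ‖x‖ ≤ ‖toLimit ℰ x‖ := by
    intro x hx
    have hc : IsClosed {x : Toeplitz ℰ | ‖x‖ ≤ ‖toLimit ℰ x‖} :=
      isClosed_le continuous_norm (map_continuous (toLimit ℰ)).norm
    refine closure_minimal ?_ hc hx
    rintro _ ⟨r, hr, rfl⟩
    change ‖incl ℰ r * ehat ℰ n‖ ≤ ‖toLimit ℰ (incl ℰ r * ehat ℰ n)‖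
    rw [map_mul, toLimit_incl, toLimit_ehat]
    refine le_trans ?_ (Limit.norm_incl_mul_echeck ℰ hr)
    refine (norm_mul_le _ _).trans ?_
    have h1 := ((univRep ℰ).isStarProjection n).norm_le
    exact (mul_le_of_le_one_right (norm_nonneg _) h1).trans
      (NonUnitalStarAlgHom.norm_apply_le (incl ℰ) r)
  refine hV _ ?_
  refine khat_le ℰ (V := V.topologicalClosure.comap
    (LinearMap.mulRight ℂ (incl ℰ b * ehat ℰ n) ∘ₗ LinearMap.mulLeft ℂ (ehat ℰ n * incl ℰ a)))
    ((Submodule.isClosed_topologicalClosure V).preimage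
      ((continuous_mul_const _).comp (continuous_const_mul _))) (fun c d => ?_) hk
  -- The corner of `c ê n d` is `E n (a c) E n (d b) ê n`, by two compressions.
  refine Submodule.le_topologicalClosure V ⟨ℰ.E n (a * c) * ℰ.E n (d * b),
    (mul_mem ((ℰ.E n).map_mem _) ((ℰ.E n).map_mem _) : _ ∈ ℛ.R n), ?_⟩
  change incl ℰ (ℰ.E n (a * c) * ℰ.E n (d * b)) * ehat ℰ n
    = ehat ℰ n * incl ℰ a * (incl ℰ c * ehat ℰ n * incl ℰ d) * (incl ℰ b * ehat ℰ n)
  calc _ = incl ℰ (ℰ.E n (a * c)) * (ehat ℰ n * incl ℰ (d * b) * ehat ℰ n) := by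
        rw [ehat_mul_incl_mul_ehat, map_mul, mul_assoc]
    _ = (ehat ℰ n * incl ℰ (a * c) * ehat ℰ n) * incl ℰ (d * b) * ehat ℰ n := by
        rw [ehat_mul_incl_mul_ehat ℰ n (a * c)]
        simp only [mul_assoc]
    _ = _ := by
        rw [map_mul, map_mul]
        simp only [mul_assoc]

/-- The corners of `k` are mapped to zero, hence vanish by `norm_corner_le`. As `khat n` is spanned
by products through `ê n`, this gives `l k m = 0` for all `l, m ∈ khat n`; with `l = m = star k` the
C*-identity forces `k = 0`. -/
theorem eq_zero_of_mem_khat {n : ℕ} {k : Toeplitz ℰ} (hk : k ∈ khat ℰ n)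
    (h0 : toLimit ℰ k = 0) : k = 0 := by
  have hbot : IsClosed ((⊥ : Submodule ℂ (Toeplitz ℰ)) : Set (Toeplitz ℰ)) := by
    rw [Submodule.bot_coe]
    exact isClosed_singleton
  have h1 : ∀ a b, ehat ℰ n * incl ℰ a * k * (incl ℰ b * ehat ℰ n) = 0 := fun a b => by
    have h := norm_corner_le ℰ a b hk
    rw [map_mul, map_mul _ _ k, h0, mul_zero, zero_mul, norm_zero] at h
    exact norm_le_zero_iff.1 h
  have h2 : ∀ l ∈ khat ℰ n, ∀ m ∈ khat ℰ n, l * (k * m) = 0 := by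
    intro l hl m hm
    refine (Submodule.mem_bot ℂ).1 (khat_mul_subset ℰ hbot (fun a b => ?_) hl)
    rw [← mul_assoc]
    refine mul_khat_subset ℰ hbot (fun c d => (Submodule.mem_bot ℂ).2 ?_) hm
    have : incl ℰ a * ehat ℰ n * incl ℰ b * k * (incl ℰ c * ehat ℰ n * incl ℰ d)
        = incl ℰ a * (ehat ℰ n * incl ℰ b * k * (incl ℰ c * ehat ℰ n)) * incl ℰ d := by
      simp only [mul_assoc]
    rw [this, h1, mul_zero, zero_mul]
  have h3 : star (k * star k) * (k * star k) = 0 := by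
    rw [star_mul, star_star, mul_assoc, h2 _ (star_mem_khat ℰ hk) _ (star_mem_khat ℰ hk), mul_zero]
  exact (CStarRing.mul_star_self_eq_zero_iff k).1 ((CStarRing.star_mul_self_eq_zero_iff _).1 h3)

/-! ### Redundancies -/

theorem of_mem_range {m n : ℕ} (h : m ≤ n) (T : CondExp.Adjointable (ℰ.E m)) :
    Limit.of ℰ m T ∈ (Limit.of ℰ n).range := by
  induction n, h using Nat.le_induction with
  | base => exact ⟨T, rfl⟩
  | succ n _ ih =>
    obtain ⟨S, hS⟩ := ih
    exact ⟨_, (InductiveLimit.of_succ (fun n => CondExp.connOp (ℰ.comp n)) n S).trans hS⟩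

/-- The range of `Limit.of n` is closed and contains the copy of `A` and every `ě m` with `m ≤ n`.
Elements of `filtration n` can therefore be studied as operators on the `n`-th module. -/
theorem toLimit_mem_range {n : ℕ} {x : Toeplitz ℰ} (hx : x ∈ filtration ℰ n) :
    toLimit ℰ x ∈ (Limit.of ℰ n).range := by
  have hc : IsClosed ((Limit.of ℰ n).range : Set (Limit ℰ)) :=
    StarAlgHom.isClosed_range (Limit.of ℰ n)
  have key : ∀ m ≤ n, khat ℰ m ≤ (Limit.of ℰ n).range.toSubalgebra.toSubmodule.comap
      (toLimit ℰ).toAlgHom.toLinearMap := by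
    refine fun m hm => khat_le ℰ (hc.preimage (map_continuous (toLimit ℰ))) fun a b => ?_
    change toLimit ℰ (incl ℰ a * ehat ℰ m * incl ℰ b) ∈ (Limit.of ℰ n).range
    rw [map_mul, map_mul]
    refine mul_mem (mul_mem ?_ (of_mem_range ℰ hm _)) ?_
    · exact ⟨_, (Limit.incl_eq ℰ n a).symm⟩
    · exact ⟨_, (Limit.incl_eq ℰ n b).symm⟩
  obtain ⟨k, hk, rfl⟩ := exists_sum_of_mem_filtration ℰ hx
  rw [map_sum]
  exact sum_mem fun i _ => key i (Nat.lt_succ_iff.1 i.2) (hk i)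

theorem sum_mem_filtration {n : ℕ} {k : Fin (n + 1) → Toeplitz ℰ}
    (hk : ∀ i : Fin (n + 1), k i ∈ khat ℰ (i : ℕ)) : ∑ i, k i ∈ filtration ℰ n :=
  sum_mem fun i _ => filtration_mono ℰ (Nat.lt_succ_iff.1 i.2) (khat_le_filtration ℰ _ (hk i))

/-- The image of the sum is an operator `T` on the `n`-th module. The redundancy condition for `a ê
n`, applied to the class of `1`, says that `T` kills the class of `a`; these classes are dense. -/
theorem toLimit_sum_eq_zero {n : ℕ} {k : Fin (n + 1) → Toeplitz ℰ} (hk : IsRedundancy ℰ n k) :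
    toLimit ℰ (∑ i, k i) = 0 := by
  obtain ⟨T, hT⟩ := toLimit_mem_range ℰ (sum_mem_filtration ℰ hk.1)
  have h0 : T = 0 := by
    refine CondExp.Adjointable.ext (CondExp.clm_ext _ fun a => ?_)
    have h1 := hk.2 _ (mul_mem_khat ℰ n a 1)
    rw [← Finset.sum_mul, map_one, mul_one] at h1
    have h2 := congrArg (toLimit ℰ) h1
    rw [map_mul, map_mul _ (incl ℰ a), ← hT, toLimit_incl, toLimit_ehat, Limit.incl_eq ℰ n,
      Limit.echeck, map_zero] at h2
    have h3 : T * (CondExp.leftMul (ℰ.E n) a * CondExp.proj (ℰ.E n)) = 0 := by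
      refine Limit.of_injective ℰ n ?_
      rw [map_mul, map_mul, map_zero]
      exact h2
    have h4 : T.toCLM ((CondExp.leftMul (ℰ.E n) a).toCLM ((CondExp.proj (ℰ.E n)).toCLM
        (CondExp.HilbertModule.incl (ℰ.E n) 1))) = 0 :=
      congrArg (fun S : CondExp.Adjointable (ℰ.E n) =>
        S.toCLM (CondExp.HilbertModule.incl (ℰ.E n) 1)) h3
    rw [CondExp.proj_incl, CondExp.map_one, CondExp.leftMul_incl, mul_one] at h4
    exact h4
  rw [← hT, h0]
  exact map_zero (Limit.of ℰ n)

theorem toLimit_eq_zero_of_mem {x : Toeplitz ℰ} (hx : x ∈ redundancyIdeal ℰ) :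
    toLimit ℰ x = 0 := by
  have hle : redundancyIdeal ℰ ≤ RingHom.ker (toLimit ℰ) := by
    refine sInf_le ⟨inferInstance, StarAlgHom.isClosed_ker (toLimit ℰ), ?_⟩
    rintro _ ⟨n, k, hk, rfl⟩
    exact toLimit_sum_eq_zero ℰ hk
  exact hle hx

/-- Any decomposition of `x` is itself a redundancy: for `y ∈ khat n` the product `x * y` is in
`khat n` and is mapped to zero, so it is zero. -/
theorem mem_redundancyIdeal {n : ℕ} {x : Toeplitz ℰ} (hx : x ∈ filtration ℰ n)
    (h0 : toLimit ℰ x = 0) : x ∈ redundancyIdeal ℰ := by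
  refine Submodule.mem_sInf.2 fun J hJ => hJ.2.2 ?_
  obtain ⟨k, hk, hxk⟩ := exists_sum_of_mem_filtration ℰ hx
  refine ⟨n, k, ⟨hk, fun y hy => ?_⟩, hxk⟩
  rw [← Finset.sum_mul, ← hxk]
  refine eq_zero_of_mem_khat ℰ (filtration_mul_khat ℰ le_rfl hx hy) ?_
  rw [map_mul, h0, zero_mul]

/-- The kernel is known only on the spaces of the filtration. A norm estimate, unlike a statement
about the kernel, passes by continuity from their dense union to the whole algebra. -/
theorem norm_q_le (x : Toeplitz ℰ) : ‖ℰ.q x‖ ≤ ‖toLimit ℰ x‖ := by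
  have hc : IsClosed {x : Toeplitz ℰ | ‖ℰ.q x‖ ≤ ‖toLimit ℰ x‖} :=
    isClosed_le (map_continuous ℰ.q).norm (map_continuous (toLimit ℰ)).norm
  refine closure_minimal ?_ hc (dense_filtration ℰ x)
  rintro x ⟨n, hx⟩
  obtain ⟨S, hS, hcl⟩ := exists_starSubalgebra_filtration ℰ n
  rw [Set.mem_ofPred_eq]
  refine le_of_forall_pos_le_add fun ε hε => ?_
  -- As `S` is closed, it is a C*-algebra and `y` can be chosen inside it. Then `x - y` is in the
  -- same space of the filtration and in the kernel, so `q x = q y`.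
  obtain ⟨y, hy, hlt⟩ := StarAlgHom.exists_norm_lt ((toLimit ℰ).comp S.subtype)
    ⟨x, (hS x).2 hx⟩ hε
  have hy' : toLimit ℰ (x - y.1) = 0 := by
    rw [map_sub, sub_eq_zero]
    exact hy.symm
  have hq : ℰ.q x = ℰ.q y.1 := (Ideal.Quotient.mk_eq_mk_iff_sub_mem _ _).2
    (mem_redundancyIdeal ℰ (sub_mem hx ((hS _).1 y.2)) hy')
  rw [hq]
  exact (CStarQuotient.norm_mk_le _ _).trans hlt.le

theorem toLimit_mem_generated (x : Toeplitz ℰ) : toLimit ℰ x ∈ Limit.generated ℰ := by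
  have hcl : IsClosed (Limit.generated ℰ : Set (Limit ℰ)) :=
    StarSubalgebra.isClosed_topologicalClosure _
  have h := eq_top_of_generators ℰ ((Limit.generated ℰ).comap (toLimit ℰ))
    (hcl.preimage (map_continuous (toLimit ℰ)))
    (fun a => StarSubalgebra.le_topologicalClosure _
      (StarAlgebra.subset_adjoin ℂ _ (Or.inl ⟨a, rfl⟩)))
    (fun n => StarSubalgebra.le_topologicalClosure _
      (StarAlgebra.subset_adjoin ℂ _ (Or.inr ⟨n, rfl⟩)))
  have hx : x ∈ (Limit.generated ℰ).comap (toLimit ℰ) := by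
    rw [h]
    trivial
  exact hx

/-- The range is already closed, so containing the generators is enough. -/
theorem generated_le_range : Limit.generated ℰ ≤ (toLimit ℰ).range := by
  refine StarSubalgebra.topologicalClosure_minimal (StarAlgebra.adjoin_le ?_)
    (StarAlgHom.isClosed_range (toLimit ℰ))
  rintro _ (⟨a, rfl⟩ | ⟨n, rfl⟩)
  · exact ⟨incl ℰ a, rfl⟩
  · exact ⟨ehat ℰ n, rfl⟩

end Toeplitz

/-! ### The algebra of the pair -/

namespace PairAlgebra

/-- The canonical *-homomorphism of the algebra of the pair into the limit. -/
noncomputable def toLimit : ℰ.PairAlgebra →⋆ₐ[ℂ] ℰ.Limit :=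
  CStarQuotient.lift (Toeplitz.redundancyIdeal ℰ) (Toeplitz.toLimit ℰ)
    fun _ hx => Toeplitz.toLimit_eq_zero_of_mem ℰ hx

theorem toLimit_injective : Function.Injective (toLimit ℰ) := by
  rw [injective_iff_map_eq_zero]
  intro z hz
  obtain ⟨x, rfl⟩ := Ideal.Quotient.mk_surjective z
  have h := Toeplitz.norm_q_le ℰ x
  rw [show Toeplitz.toLimit ℰ x = 0 from hz, norm_zero] at h
  exact norm_le_zero_iff.1 h

/-- The map into the limit, with its range as codomain. -/
noncomputable def toGenerated : ℰ.PairAlgebra →⋆ₐ[ℂ] Limit.generated ℰ :=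
  (toLimit ℰ).codRestrict (Limit.generated ℰ) fun z => by
    obtain ⟨x, rfl⟩ := Ideal.Quotient.mk_surjective z
    exact Toeplitz.toLimit_mem_generated ℰ x

theorem toGenerated_bijective : Function.Bijective (toGenerated ℰ) := by
  refine ⟨fun x y h => toLimit_injective ℰ (congrArg Subtype.val h), fun y => ?_⟩
  obtain ⟨x, hx⟩ := Toeplitz.generated_le_range ℰ y.2
  exact ⟨ℰ.q x, Subtype.ext hx⟩

end PairAlgebra

end CondExpSeq

end LimitRealization

theorem theorem3p6 {A : Type u} [CStarAlgebra A] [PartialOrder A] [StarOrderedRing A]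
    (ℛ : ApproxProper A) (ℰ : CondExpSeq ℛ) :
    ∃ πhat : ℰ.Toeplitz →⋆ₐ[ℂ] ℰ.Limit,
      (∀ a, πhat (CondExpSeq.Toeplitz.incl ℰ a) = CondExpSeq.Limit.incl ℰ a) ∧
      (∀ n, πhat (CondExpSeq.Toeplitz.ehat ℰ n) = CondExpSeq.Limit.echeck ℰ n) ∧
      (∀ ρ : ℰ.Toeplitz →⋆ₙₐ[ℂ] ℰ.Limit,
        (∀ a, ρ (CondExpSeq.Toeplitz.incl ℰ a) = CondExpSeq.Limit.incl ℰ a) →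
        (∀ n, ρ (CondExpSeq.Toeplitz.ehat ℰ n) = CondExpSeq.Limit.echeck ℰ n) →
        ∀ x, ρ x = πhat x) ∧
      (∀ x ∈ CondExpSeq.Toeplitz.redundancyIdeal ℰ, πhat x = 0) ∧
      ∃ π : ℰ.PairAlgebra →⋆ₐ[ℂ] ℰ.Limit,
        (∀ x, π (ℰ.q x) = πhat x) ∧
        (∀ a, π (ℰ.q (CondExpSeq.Toeplitz.incl ℰ a)) = CondExpSeq.Limit.incl ℰ a) ∧
        (∀ n, π (ℰ.e n) = CondExpSeq.Limit.echeck ℰ n) ∧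
        Function.Injective π ∧
        (∃ Θ : ℰ.PairAlgebra ≃⋆ₐ[ℂ] CondExpSeq.Limit.generated ℰ,
          ∀ x, (Θ x).1 = π x) ∧
        Function.Injective (CondExpSeq.Toeplitz.incl ℰ) ∧
        Function.Injective (fun a => ℰ.q (CondExpSeq.Toeplitz.incl ℰ a)) := by
  refine ⟨CondExpSeq.Toeplitz.toLimit ℰ, fun _ => rfl, fun _ => rfl,
    CondExpSeq.Toeplitz.eq_toLimit ℰ,
    fun _ => CondExpSeq.Toeplitz.toLimit_eq_zero_of_mem ℰ,
    CondExpSeq.PairAlgebra.toLimit ℰ, fun _ => rfl, fun _ => rfl, fun _ => rfl,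
    CondExpSeq.PairAlgebra.toLimit_injective ℰ,
    ⟨StarAlgEquiv.ofBijective _ (CondExpSeq.PairAlgebra.toGenerated_bijective ℰ), fun _ => rfl⟩,
    CondExpSeq.Toeplitz.incl_injective ℰ, fun a b h => ?_⟩
  -- Composed with `π`, the map `a ↦ q (incl a)` is the injective copy of `A` in the limit.
  exact CondExpSeq.Limit.incl_injective ℰ (congrArg (CondExpSeq.PairAlgebra.toLimit ℰ) h)
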